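/- **Theorem 4.1.** Let $(X,x)$ be a pointed topological space and let $k\ge 1$. Let $\mathrm{HTop}_*$ be the pointed homotopy category and $\mathrm{HPol}_*$ its full subcategory of pointed spaces having the pointed homotopy type of a pointed polyhedron. *Notions.* For inverse systems $\mathbf X=(X_\lambda,p_{\lambda\lambda'},\Lambda)$, $\mathbf Y=(Y_\mu,q_{\mu\mu'},M)$ over nonempty directed sets, an $S^*$-morphism $(f,f^n_\mu):\mathbf X\to\mathbf Y$ consists of a function $f:M\to\Lambda$ and morphisms $f^n_\mu:X_{f(\mu)}\to Y_\mu$ ($n\in\mathbb N$, $\mu\in M$) such that for all $\mu\le\mu'$ there are $\lambda\ge f(\mu),f(\mu')$ and $n$ with $q_{\mu\mu'}f^{n'}_{\mu'}p_{f(\mu')\lambda}=f^{n'}_\mu p_{f(\mu)\lambda}$ for all $n'\ge n$. Two $S^*$-morphisms $(f,f^n_\mu)$, $(g,g^n_\mu)$ are equivalent if for every $\mu$ there are $\lambda\ge f(\mu),g(\mu)$ and $n$ with $f^{n'}_\mu p_{f(\mu)\lambda}=g^{n'}_\mu p_{g(\mu)\lambda}$ for all $n'\ge n$. The equivalence classes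 are the morphisms of the category $\mathrm{pro}^*$; composition is $(g,g^n_\nu)(f,f^n_\mu)=(fg,\,g^n_\nu f^n_{g(\nu)})$. An $\mathrm{HPol}_*$-expansion $\mathbf p:A\to\mathbf A$ of a pointed space $A$ is a family of morphisms $p_\lambda:A\to A_\lambda$ of $\mathrm{HTop}_*$, compatible with the bonding morphisms of an inverse system $\mathbf A=(A_\lambda,p_{\lambda\lambda'},\Lambda)$ in $\mathrm{HPol}_*$, such that every morphism $A\to Q$ with $Q\in\mathrm{HPol}_*$ factors through some $p_\lambda$, and any $f_0,f_1:A_\lambda\to Q$ with $f_0p_\lambda=f_1p_\lambda$ satisfy $f_0p_{\lambda\lambda'}=f_1p_{\lambda\lambda'}$ for some $\lambda'\ge\lambda$. A coarse shape morphism $B\to A$ is a class $\langle\mathbf f^*\rangle$ of $\mathrm{pro}^*$-morphisms $\mathbf f^*:\mathbf B\to\mathbf A$ between expanding systems of $B$ and of $A$, where $\mathbf f^*:\mathbf B\to\mathbf A$ and $\mathbf f'^*:\mathbf B'\to\mathbf A'$ are identified if they form a commutative square with the natural isomorphisms $\mathbf B\cong\mathbf B'$ and $\mathbf A\cong\mathbf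 A'$. These classes form $Sh^*(B,A)$ and are composed by representatives; each $p_\lambda$ is regarded as a coarse shape morphism $A\to A_\lambda$. *Claim.* The sphere $(S^k,*)$ is an object of $\mathrm{HPol}_*$, hence is its own (one-term) expansion, and the set $$\check\pi^*_k(X,x)=Sh^*((S^k,*),(X,x))$$ carries a group structure and a topology such that: 1. for every $\mathrm{HPol}_*$-expansion $\mathbf p:(X,x)\to\mathbf X$ and all $S^*$-morphisms $(f^n_\lambda),(g^n_\lambda):(S^k,*)\to\mathbf X$, $$\langle[(f^n_\lambda)]\rangle+\langle[(g^n_\lambda)]\rangle=\langle[(f^n_\lambda+g^n_\lambda)]\rangle,$$ where $f^n_\lambda+g^n_\lambda$ is the concatenation of $k$-dimensional loops in $X_\lambda$ (the operation of $\pi_k(X_\lambda,x_\lambda)$); 2. for every $\mathrm{HPol}_*$-expansion $\mathbf p:(X,x)\to\mathbf X$, the sets $V_\lambda^{F^*}=\{G^*: p_\lambda\circ G^*=p_\lambda\circ F^*\}$, with $\lambda\in\Lambda$ and $F^*\in\check\pi^*_k(X,x)$, form a basis of the topology; 3. with this topology $\check\pi^*_k(X,x)$ is a topological group, i.e. the group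 operation and the inversion are continuous. -/

import Mathlib

open CategoryTheory Topology unitInterval
open scoped Topology.Homotopy

universe w v u

/-! # Inverse systems, the category `pro*-C`, expansions and coarse shape morphisms -/

namespace CoarseShape

/-- An inverse system in `C` over a nonempty directed preordered index set. -/
structure InvSystem (C : Type u) [Category.{v} C] where
  /-- the index set -/
  Idx : Type w
  [pre : Preorder Idx]
  [dir : IsDirectedOrder Idx]
  [ne : Nonempty Idx]
  /-- the terms -/
  obj : Idx → C
  /-- the bonding morphisms -/
  bond : ∀ {a b : Idx}, a ≤ b → (obj b ⟶ obj a)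
  bond_self : ∀ (a : Idx) (h : a ≤ a), bond h = 𝟙 (obj a)
  bond_comp : ∀ {a b c : Idx} (h : a ≤ b) (h' : b ≤ c),
    bond h' ≫ bond h = bond (h.trans h')

attribute [instance] InvSystem.pre InvSystem.dir InvSystem.ne
attribute [simp] InvSystem.bond_self InvSystem.bond_comp

section ProStar

variable {C : Type u} [Category.{v} C]

/-- Two sequences `f n : X_a ⟶ Z` and `g n : X_b ⟶ Z` *eventually agree* when, for some
`c ≥ a, b` and some `N`, they agree after restriction to `X_c` for all `n ≥ N`. -/
def EvAgree (X : InvSystem.{w} C) {a b : X.Idx} {Z : C}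
    (f : ℕ → (X.obj a ⟶ Z)) (g : ℕ → (X.obj b ⟶ Z)) : Prop :=
  ∃ (c : X.Idx) (ha : a ≤ c) (hb : b ≤ c) (N : ℕ), ∀ n, N ≤ n →
    X.bond ha ≫ f n = X.bond hb ≫ g n

namespace EvAgree

variable {X : InvSystem.{w} C} {a b c : X.Idx} {Z W : C}

theorem refl (f : ℕ → (X.obj a ⟶ Z)) : EvAgree X f f :=
  ⟨a, le_rfl, le_rfl, 0, fun _ _ => rfl⟩

theorem symm {f : ℕ → (X.obj a ⟶ Z)} {g : ℕ → (X.obj b ⟶ Z)} (h : EvAgree X f g) :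
    EvAgree X g f := by
  obtain ⟨c, ha, hb, N, H⟩ := h
  exact ⟨c, hb, ha, N, fun n hn => (H n hn).symm⟩

theorem restrict {f : ℕ → (X.obj a ⟶ Z)} {g : ℕ → (X.obj b ⟶ Z)} {c : X.Idx} {ha : a ≤ c}
    {hb : b ≤ c} {n : ℕ} (H : X.bond ha ≫ f n = X.bond hb ≫ g n) {d : X.Idx} (hd : c ≤ d) :
    X.bond (ha.trans hd) ≫ f n = X.bond (hb.trans hd) ≫ g n := by
  rw [← X.bond_comp ha hd, ← X.bond_comp hb hd, Category.assoc, Category.assoc, H]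

theorem trans {f : ℕ → (X.obj a ⟶ Z)} {g : ℕ → (X.obj b ⟶ Z)} {h : ℕ → (X.obj c ⟶ Z)}
    (h₁ : EvAgree X f g) (h₂ : EvAgree X g h) : EvAgree X f h := by
  obtain ⟨d, ha, hb, N, H⟩ := h₁
  obtain ⟨e, hb', hc, M, H'⟩ := h₂
  obtain ⟨l, hd, he⟩ := exists_ge_ge d e
  refine ⟨l, ha.trans hd, hc.trans he, max N M, fun n hn => ?_⟩
  exact (restrict (H n (le_of_max_le_left hn)) hd).trans
    (restrict (H' n (le_of_max_le_right hn)) he)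

theorem postcomp {f : ℕ → (X.obj a ⟶ Z)} {g : ℕ → (X.obj b ⟶ Z)} (h : EvAgree X f g)
    (k : ℕ → (Z ⟶ W)) : EvAgree X (fun n => f n ≫ k n) (fun n => g n ≫ k n) := by
  obtain ⟨c, ha, hb, N, H⟩ := h
  refine ⟨c, ha, hb, N, fun n hn => ?_⟩
  rw [← Category.assoc, H n hn, Category.assoc]

theorem of_eventually_eq {f g : ℕ → (X.obj a ⟶ Z)} (N : ℕ) (h : ∀ n, N ≤ n → f n = g n) :
    EvAgree X f g :=
  ⟨a, le_rfl, le_rfl, N, fun n hn => by rw [h n hn]⟩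

end EvAgree

/-- An `S*`-morphism of inverse systems. -/
structure StarMor (X Y : InvSystem.{w} C) where
  /-- the index function -/
  idx : Y.Idx → X.Idx
  /-- the morphisms `f^n_μ : X_{f(μ)} ⟶ Y_μ` -/
  mor : ∀ (_n : ℕ) (m : Y.Idx), X.obj (idx m) ⟶ Y.obj m
  comm : ∀ {m m' : Y.Idx} (h : m ≤ m'),
    EvAgree X (fun n => mor n m' ≫ Y.bond h) (fun n => mor n m)

namespace StarMor

variable {X Y Z : InvSystem.{w} C}

/-- Precomposing eventually agreeing sequences with an `S*`-morphism. -/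
theorem precomp (f : StarMor X Y) {W : C} {a b : Y.Idx} {g : ℕ → (Y.obj a ⟶ W)}
    {g' : ℕ → (Y.obj b ⟶ W)} (h : EvAgree Y g g') :
    EvAgree X (fun n => f.mor n a ≫ g n) (fun n => f.mor n b ≫ g' n) := by
  obtain ⟨c, ha, hb, N, H⟩ := h
  have h₁ := ((f.comm ha).postcomp g).symm
  have h₂ := (f.comm hb).postcomp g'
  refine (h₁.trans ?_).trans h₂
  refine EvAgree.of_eventually_eq N fun n hn => ?_
  simp only [Category.assoc, H n hn]

/-- Equivalence of `S*`-morphisms. -/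
def Equiv (f g : StarMor X Y) : Prop :=
  ∀ m : Y.Idx, EvAgree X (fun n => f.mor n m) (fun n => g.mor n m)

instance setoid (X Y : InvSystem.{w} C) : Setoid (StarMor X Y) where
  r := Equiv
  iseqv := ⟨fun _ _ => EvAgree.refl _, fun h m => (h m).symm, fun h h' m => (h m).trans (h' m)⟩

/-- The identity `S*`-morphism. -/
def id (X : InvSystem.{w} C) : StarMor X X where
  idx m := m
  mor _ m := 𝟙 (X.obj m)
  comm {m m'} h := ⟨m', le_rfl, h, 0, fun n _ => by simp⟩

/-- Composition of `S*`-morphisms, in diagrammatic order. -/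
def comp (f : StarMor X Y) (g : StarMor Y Z) : StarMor X Z where
  idx l := f.idx (g.idx l)
  mor n l := f.mor n (g.idx l) ≫ g.mor n l
  comm h := by simpa only [Category.assoc] using f.precomp (g.comm h)

theorem comp_congr {f f' : StarMor X Y} {g g' : StarMor Y Z} (hf : f.Equiv f')
    (hg : g.Equiv g') : (f.comp g).Equiv (f'.comp g') := fun l =>
  (f.precomp (hg l)).trans ((hf (g'.idx l)).postcomp fun n => g'.mor n l)

end StarMor

/-- The category `pro*-C`: its objects are the inverse systems in `C`, its morphisms are the
equivalence classes of `S*`-morphisms. -/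
instance : Category (InvSystem.{w} C) where
  Hom X Y := Quotient (StarMor.setoid X Y)
  id X := Quotient.mk _ (StarMor.id X)
  comp {X Y Z} := Quotient.map₂ StarMor.comp fun _ _ hf _ _ hg => StarMor.comp_congr hf hg
  id_comp := by
    rintro X Y ⟨f⟩
    refine Quotient.sound fun m => EvAgree.of_eventually_eq 0 fun n _ => ?_
    exact Category.id_comp _
  comp_id := by
    rintro X Y ⟨f⟩
    refine Quotient.sound fun m => EvAgree.of_eventually_eq 0 fun n _ => ?_
    exact Category.comp_id _
  assoc := by
    rintro W X Y Z ⟨f⟩ ⟨g⟩ ⟨h⟩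
    refine Quotient.sound fun m => EvAgree.of_eventually_eq 0 fun n _ => ?_
    exact Category.assoc _ _ _

/-- The `pro*`-morphism represented by an `S*`-morphism. -/
def StarMor.toPro {X Y : InvSystem.{w} C} (f : StarMor X Y) : X ⟶ Y :=
  Quotient.mk (StarMor.setoid X Y) f

/-- The rudimentary system, with the single term `A`. -/
def rudimentary (A : C) : InvSystem.{w} C where
  Idx := PUnit.{w + 1}
  obj _ := A
  bond _ := 𝟙 A
  bond_self _ _ := rfl
  bond_comp _ _ := Category.id_comp _

/-- A morphism of inverse systems in the ordinary sense (a representative of a morphism of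
`pro-C`). -/
structure OrdMor (X Y : InvSystem.{w} C) where
  /-- the index function -/
  idx : Y.Idx → X.Idx
  /-- the morphisms `f_μ : X_{f(μ)} ⟶ Y_μ` -/
  mor : ∀ m : Y.Idx, X.obj (idx m) ⟶ Y.obj m
  comm : ∀ {m m' : Y.Idx} (h : m ≤ m'), ∃ (c : X.Idx) (h' : idx m' ≤ c) (h'' : idx m ≤ c),
    X.bond h' ≫ mor m' ≫ Y.bond h = X.bond h'' ≫ mor m

/-- The functor from `pro-C` to `pro*-C` on representatives: every `f^n_μ` is `f_μ`. -/
def OrdMor.toStar {X Y : InvSystem.{w} C} (f : OrdMor X Y) : StarMor X Y where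
  idx := f.idx
  mor _ m := f.mor m
  comm h := by
    obtain ⟨c, h', h'', H⟩ := f.comm h
    exact ⟨c, h', h'', 0, fun _ _ => H⟩

end ProStar

section Shape

variable {C : Type u} [Category.{v} C]

/-- A `P`-expansion of `A`: a morphism of `pro-C` from `A` to an inverse system of objects of the
full subcategory `P`, such that every morphism from `A` to an object of `P` factors through a term
(`factor`), uniquely up to passing to a later term (`separate`). -/
structure Expansion (P : ObjectProperty C) (A : C) where
  /-- the expanding system -/
  sys : InvSystem.{w} C
  mem : ∀ l : sys.Idx, P (sys.obj l)
  /-- the projections `p_λ : A ⟶ X_λ` -/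
  proj : ∀ l : sys.Idx, A ⟶ sys.obj l
  proj_bond : ∀ {l l' : sys.Idx} (h : l ≤ l'), proj l' ≫ sys.bond h = proj l
  factor : ∀ (Q : C), P Q → ∀ h : A ⟶ Q, ∃ (l : sys.Idx) (f : sys.obj l ⟶ Q), proj l ≫ f = h
  separate : ∀ (Q : C), P Q → ∀ (l : sys.Idx) (f₀ f₁ : sys.obj l ⟶ Q),
    proj l ≫ f₀ = proj l ≫ f₁ →
    ∃ (l' : sys.Idx) (h : l ≤ l'), sys.bond h ≫ f₀ = sys.bond h ≫ f₁

namespace Expansion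

variable {P : ObjectProperty C} {A : C}

/-- The rudimentary expansion of an object of `P`. -/
def rud (hA : P A) : Expansion.{w} P A where
  sys := rudimentary A
  mem _ := hA
  proj _ := 𝟙 A
  proj_bond _ := Category.id_comp _
  factor _ _ h := ⟨PUnit.unit, h, Category.id_comp _⟩
  separate _ _ l _ _ h := ⟨l, le_rfl, h⟩

/-- Morphisms out of two terms of an expansion which agree on `A` agree on a later term. -/
theorem agree (p : Expansion.{w} P A) {Q : C} (hQ : P Q) {a b : p.sys.Idx}
    (f : p.sys.obj a ⟶ Q) (g : p.sys.obj b ⟶ Q) (h : p.proj a ≫ f = p.proj b ≫ g) :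
    ∃ (c : p.sys.Idx) (ha : a ≤ c) (hb : b ≤ c), p.sys.bond ha ≫ f = p.sys.bond hb ≫ g := by
  obtain ⟨d, ha, hb⟩ := exists_ge_ge a b
  obtain ⟨c, hc, H⟩ := p.separate Q hQ d (p.sys.bond ha ≫ f) (p.sys.bond hb ≫ g) (by
    rw [← Category.assoc, ← Category.assoc, p.proj_bond, p.proj_bond, h])
  refine ⟨c, ha.trans hc, hb.trans hc, ?_⟩
  rwa [← Category.assoc, ← Category.assoc, p.sys.bond_comp, p.sys.bond_comp] at H

/-- The natural morphism `i : 𝐗 ⟶ 𝐗'` between two expansions `p`, `p'` of `A` is the one with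
`i p = p'`. -/
def IsNatural (p p' : Expansion.{w} P A) (i : OrdMor p.sys p'.sys) : Prop :=
  ∀ m : p'.sys.Idx, p.proj (i.idx m) ≫ i.mor m = p'.proj m

theorem exists_natural (p p' : Expansion.{w} P A) : ∃ i, IsNatural p p' i := by
  choose idx mor hmor using fun m => p.factor _ (p'.mem m) (p'.proj m)
  refine ⟨⟨idx, mor, fun {m m'} h => ?_⟩, hmor⟩
  refine p.agree (p'.mem m) _ _ ?_
  rw [← Category.assoc, hmor, hmor, p'.proj_bond]

/-- The `pro*`-isomorphism induced by the natural morphism between two expansions of `A`. -/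
noncomputable def nat (p p' : Expansion.{w} P A) : p.sys ⟶ p'.sys :=
  (exists_natural p p').choose.toStar.toPro

/-- The natural morphism is unique, even in `pro*-C`. -/
theorem natural_unique {p p' : Expansion.{w} P A} {f g : StarMor p.sys p'.sys}
    (hf : ∀ n m, p.proj (f.idx m) ≫ f.mor n m = p'.proj m)
    (hg : ∀ n m, p.proj (g.idx m) ≫ g.mor n m = p'.proj m)
    (hfc : ∀ n n' m, f.mor n m = f.mor n' m) (hgc : ∀ n n' m, g.mor n m = g.mor n' m) :
    f.toPro = g.toPro := by
  refine Quotient.sound fun m => ?_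
  obtain ⟨c, ha, hb, H⟩ := p.agree (p'.mem m) (f.mor 0 m) (g.mor 0 m) (by rw [hf, hg])
  exact ⟨c, ha, hb, 0, fun n _ => by
    simpa only [hfc n 0, hgc n 0] using H⟩

theorem nat_eq {p p' : Expansion.{w} P A} {i : OrdMor p.sys p'.sys} (hi : IsNatural p p' i) :
    nat p p' = i.toStar.toPro :=
  natural_unique (fun _ => (exists_natural p p').choose_spec) (fun _ => hi)
    (fun _ _ _ => rfl) (fun _ _ _ => rfl)

@[simp]
theorem nat_self (p : Expansion.{w} P A) : nat p p = 𝟙 p.sys :=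
  natural_unique (g := StarMor.id p.sys) (fun _ => (exists_natural p p).choose_spec)
    (fun _ _ => Category.comp_id _) (fun _ _ _ => rfl) (fun _ _ _ => rfl)

@[simp]
theorem nat_comp (p p' p'' : Expansion.{w} P A) : nat p p' ≫ nat p' p'' = nat p p'' := by
  refine natural_unique (f := ((exists_natural p p').choose.toStar).comp
    ((exists_natural p' p'').choose.toStar)) (fun _ m => ?_)
    (fun _ => (exists_natural p p'').choose_spec) (fun _ _ _ => rfl) (fun _ _ _ => rfl)
  have h := (exists_natural p p').choose_spec
  have h' := (exists_natural p' p'').choose_spec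
  exact (Category.assoc _ _ _).symm.trans ((congrArg (· ≫ _) (h _)).trans (h' m))

@[simp]
theorem nat_comp_assoc (p p' p'' : Expansion.{w} P A) {Z : InvSystem.{w} C} (f : p''.sys ⟶ Z) :
    nat p p' ≫ nat p' p'' ≫ f = nat p p'' ≫ f := by
  rw [← Category.assoc, nat_comp]

end Expansion

/-- A representative of a coarse shape morphism from `B` to `A`: expansions of `B` and of `A`, and
a morphism of `pro*-P` between the expanding systems. -/
structure Rep (P : ObjectProperty C) (B A : C) where
  src : Expansion.{w} P B
  tgt : Expansion.{w} P A
  mor : src.sys ⟶ tgt.sys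

/-- `pro*-P` equivalence: the square formed with the natural isomorphisms commutes. -/
instance repSetoid (P : ObjectProperty C) (B A : C) : Setoid (Rep.{w} P B A) where
  r f g := Expansion.nat f.src g.src ≫ g.mor = f.mor ≫ Expansion.nat f.tgt g.tgt
  iseqv := by
    refine ⟨fun f => by simp, fun {f g} h => ?_, fun {f g k} h h' => ?_⟩
    · have := congrArg (fun t => Expansion.nat g.src f.src ≫ t ≫ Expansion.nat g.tgt f.tgt) h
      simpa using this.symm
    · rw [← Expansion.nat_comp f.src g.src k.src, Category.assoc, h', ← Category.assoc, h,
        Category.assoc, Expansion.nat_comp]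

/-- The coarse shape morphisms `Sh*(B, A)` for the pair `(C, P)`. -/
def Sh (P : ObjectProperty C) (B A : C) : Type _ :=
  Quotient (repSetoid.{w} P B A)

namespace Sh

variable {P : ObjectProperty C} {A B D : C}

/-- The coarse shape morphism represented by a morphism `f` of `pro*-P`. -/
def mk (q : Expansion.{w} P B) (p : Expansion.{w} P A) (f : q.sys ⟶ p.sys) : Sh.{w} P B A :=
  Quotient.mk (repSetoid P B A) ⟨q, p, f⟩

/-- Composition of coarse shape morphisms, in diagrammatic order. -/
noncomputable def comp : Sh.{w} P D B → Sh.{w} P B A → Sh.{w} P D A :=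
  Quotient.map₂ (fun f g => ⟨f.src, g.tgt, f.mor ≫ Expansion.nat f.tgt g.src ≫ g.mor⟩) (by
    intro f f' hf g g' hg
    replace hf : Expansion.nat f.src f'.src ≫ f'.mor = f.mor ≫ Expansion.nat f.tgt f'.tgt := hf
    replace hg : Expansion.nat g.src g'.src ≫ g'.mor = g.mor ≫ Expansion.nat g.tgt g'.tgt := hg
    change Expansion.nat f.src f'.src ≫ f'.mor ≫ Expansion.nat f'.tgt g'.src ≫ g'.mor =
      (f.mor ≫ Expansion.nat f.tgt g.src ≫ g.mor) ≫ Expansion.nat g.tgt g'.tgt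
    rw [← Category.assoc, hf]
    simp only [Category.assoc, ← hg, Expansion.nat_comp_assoc])

/-- The coarse shape morphism `A ⟶ X_λ` induced by the projection `p_λ` of an expansion `p`. -/
def proj (p : Expansion.{w} P A) (l : p.sys.Idx) : Sh.{w} P A (p.sys.obj l) :=
  mk p (Expansion.rud (p.mem l)) (OrdMor.toStar (X := p.sys) (Y := rudimentary (p.sys.obj l))
    { idx := fun _ => l
      mor := fun _ => 𝟙 _
      comm := fun _ => ⟨l, le_rfl, le_rfl, by simp [rudimentary]⟩ }).toPro

/-- For an expansion `p` of `A`, the basic set `V_λ^F` of all `G` with `p_λ ∘ G = p_λ ∘ F`. -/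
def basicSet (p : Expansion.{w} P A) (l : p.sys.Idx) (F : Sh.{w} P B A) : Set (Sh.{w} P B A) :=
  {G | comp G (proj p l) = comp F (proj p l)}

end Sh

end Shape

/-! # The pointed homotopy category and pointed polyhedra -/

/-- A pointed topological space. -/
structure PSpace where
  /-- the underlying space -/
  carrier : Type u
  [top : TopologicalSpace carrier]
  /-- the base point -/
  pt : carrier

attribute [instance] PSpace.top

/-- Pointed continuous maps. -/
def PMap (X Y : PSpace.{u}) : Type u :=
  {f : C(X.carrier, Y.carrier) // f X.pt = Y.pt}

namespace PMap

variable {X Y Z : PSpace.{u}}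

/-- Pointed homotopy. -/
instance setoid (X Y : PSpace.{u}) : Setoid (PMap X Y) where
  r f g := f.1.HomotopicRel g.1 {X.pt}
  iseqv := ⟨fun _ => .refl _, fun h => h.symm, fun h h' => h.trans h'⟩

/-- Composition of pointed maps, in diagrammatic order. -/
def comp (f : PMap X Y) (g : PMap Y Z) : PMap X Z :=
  ⟨g.1.comp f.1, by rw [ContinuousMap.comp_apply, f.2, g.2]⟩

theorem comp_congr {f f' : PMap X Y} {g g' : PMap Y Z}
    (hf : f.1.HomotopicRel f'.1 {X.pt}) (hg : g.1.HomotopicRel g'.1 {Y.pt}) :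
    (f.comp g).1.HomotopicRel (f'.comp g').1 {X.pt} := by
  obtain ⟨F⟩ := hf
  obtain ⟨G⟩ := hg
  refine ⟨⟨G.toHomotopy.comp F.toHomotopy, ?_⟩⟩
  rintro t x rfl
  change G (t, F (t, X.pt)) = g.1 (f.1 X.pt)
  rw [F.eq_fst t rfl, f.2, G.eq_fst t rfl]

end PMap

/-- The pointed homotopy category `HTop_*`: the morphisms are the pointed homotopy classes. -/
instance : Category PSpace.{u} where
  Hom X Y := Quotient (PMap.setoid X Y)
  id X := Quotient.mk _ ⟨ContinuousMap.id _, rfl⟩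
  comp {X Y Z} := Quotient.map₂ PMap.comp fun _ _ hf _ _ hg => PMap.comp_congr hf hg
  id_comp := by
    rintro X Y ⟨f⟩
    rfl
  comp_id := by
    rintro X Y ⟨f⟩
    rfl
  assoc := by
    rintro W X Y Z ⟨f⟩ ⟨g⟩ ⟨h⟩
    rfl

/-- The homotopy class of a pointed map. -/
def PMap.cls {X Y : PSpace.{u}} (f : PMap X Y) : X ⟶ Y :=
  Quotient.mk (PMap.setoid X Y) f

section Polyhedra

variable {V : Type u}

/-- The closed simplex with vertex set `s`, in barycentric coordinates. As all coordinates outside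
`s` vanish, its topology as a subspace of `V → ℝ` is the Euclidean one. -/
def closedSimplex (s : Finset V) : Set (V → ℝ) :=
  {b | (∀ v, 0 ≤ b v) ∧ (∀ v, v ∉ s → b v = 0) ∧ ∑ v ∈ s, b v = 1}

/-- The points of the geometric realization `|K|` of a simplicial complex. -/
def Realization (K : AbstractSimplicialComplex V) : Type u :=
  {b : V → ℝ // ∃ s ∈ K.faces, b ∈ closedSimplex s}

/-- The inclusion of a closed simplex of `K` in `|K|`. -/
def Realization.incl (K : AbstractSimplicialComplex V) (s : K.faces) :
    closedSimplex s.1 → Realization K :=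
  fun b => ⟨b.1, s.1, s.2, b.2⟩

/-- The weak (CW) topology: a set is open if and only if its trace on every closed simplex is
open. -/
instance (K : AbstractSimplicialComplex V) : TopologicalSpace (Realization K) :=
  ⨆ s : K.faces, TopologicalSpace.coinduced (Realization.incl K s) inferInstance

open Classical in
/-- A vertex of `K` as a point of `|K|`. -/
noncomputable def Realization.vertex (K : AbstractSimplicialComplex V) (v : V) : Realization K :=
  ⟨Pi.single v 1, {v}, K.singleton_mem v, by
    refine ⟨fun w => ?_, fun w hw => ?_, by simp⟩
    · by_cases h : w = v
      · subst h; simp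
      · simp [h]
    · simp [show w ≠ v by simpa using hw]⟩

/-- The pointed polyhedron `(|K|, v)`. Taking a vertex as the base point is no restriction, since
every point of a polyhedron is a vertex of some triangulation. -/
noncomputable def pointedPolyhedron (K : AbstractSimplicialComplex V) (v : V) : PSpace.{u} where
  carrier := Realization K
  pt := Realization.vertex K v

end Polyhedra

/-- The full subcategory `HPol_*` of `HTop_*`: the pointed spaces which have the pointed homotopy
type of a pointed polyhedron. -/
def HPol : ObjectProperty PSpace.{u} := fun X =>
  ∃ (V : Type u) (K : AbstractSimplicialComplex V) (v : V),
    Nonempty (X ≅ pointedPolyhedron K v)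

/-! # The sphere and the concatenation of maps defined on it -/

/-- The pointed sphere `(S^k, *)`, the unit sphere of `ℝ^(k+1)` with base point `e₀`. -/
noncomputable def sphere (k : ℕ) : PSpace.{u} where
  carrier := ULift.{u} (Metric.sphere (0 : EuclideanSpace ℝ (Fin (k + 1))) 1)
  pt := ⟨EuclideanSpace.single 0 1, by simp⟩

namespace Collapse

variable {k : ℕ}

/-- The point `t` of the cube `[0,1]^k` in the coordinates of `[-1,1]^k`. -/
def ctr (t : I^(Fin k)) : Fin k → ℝ := fun i => 2 * (t i : ℝ) - 1

/-- `1 - ‖y‖_∞`, the distance from the boundary of the cube `[-1,1]^k`. -/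
noncomputable def dep (y : Fin k → ℝ) : ℝ := 1 - ‖y‖

/-- `|y|²`. -/
def sq (y : Fin k → ℝ) : ℝ := ∑ i, y i ^ 2

/-- Inverse stereographic projection from `e₀`, applied to `y / (1 - ‖y‖_∞)`. -/
noncomputable def vec (y : Fin k → ℝ) : EuclideanSpace ℝ (Fin (k + 1)) :=
  WithLp.toLp 2 (Fin.cons ((sq y - dep y ^ 2) / (sq y + dep y ^ 2))
    fun i => 2 * dep y * y i / (sq y + dep y ^ 2))

theorem sq_nonneg (y : Fin k → ℝ) : 0 ≤ sq y := Finset.sum_nonneg fun _ _ => _root_.sq_nonneg _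

theorem den_pos (y : Fin k → ℝ) : 0 < sq y + dep y ^ 2 := by
  by_cases h : y = 0
  · subst h
    have := sq_nonneg (0 : Fin k → ℝ)
    simp [dep]
    linarith
  · have : 0 < sq y := by
      obtain ⟨i, hi⟩ := Function.ne_iff.1 h
      exact Finset.sum_pos' (fun _ _ => _root_.sq_nonneg _)
        ⟨i, Finset.mem_univ _, pow_pos_of_ne i hi⟩
    positivity
where
  pow_pos_of_ne (i : Fin k) (hi : y i ≠ 0) : 0 < y i ^ 2 := by positivity

theorem vec_mem (y : Fin k → ℝ) : vec y ∈ Metric.sphere (0 : EuclideanSpace ℝ (Fin (k + 1))) 1 := by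
  have hd := den_pos y
  rw [mem_sphere_zero_iff_norm, EuclideanSpace.norm_eq, Real.sqrt_eq_one, Fin.sum_univ_succ]
  simp only [vec, Fin.cons_zero, Fin.cons_succ, Real.norm_eq_abs, sq_abs, div_pow, mul_pow,
    ← Finset.sum_div, ← Finset.mul_sum]
  change _ + 2 ^ 2 * dep y ^ 2 * sq y / _ = 1
  field_simp
  ring

theorem continuous_vec : Continuous (vec (k := k)) := by
  have h₁ : Continuous (sq (k := k)) := by unfold sq; fun_prop
  have h₂ : Continuous (dep (k := k)) := by unfold dep; fun_prop
  refine (PiLp.continuous_toLp 2 _).comp (continuous_pi fun j => ?_)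
  refine Fin.cases ?_ (fun i => ?_) j
  · exact (h₁.sub (h₂.pow 2)).div (h₁.add (h₂.pow 2)) fun y => (den_pos y).ne'
  · exact ((continuous_const.mul h₂).mul (continuous_apply i)).div (h₁.add (h₂.pow 2))
      fun y => (den_pos y).ne'

theorem norm_ctr_le (t : I^(Fin k)) : ‖ctr t‖ ≤ 1 := by
  refine (pi_norm_le_iff_of_nonneg zero_le_one).2 fun i => ?_
  rw [Real.norm_eq_abs, abs_le]
  have := (t i).2.1
  have := (t i).2.2
  constructor <;> simp only [ctr] <;> linarith

theorem dep_nonneg (t : I^(Fin k)) : 0 ≤ dep (ctr t) := sub_nonneg.2 (norm_ctr_le t)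

theorem ctr_injective : Function.Injective (ctr (k := k)) := by
  intro t t' h
  ext i
  have := congrFun h i
  simp only [ctr] at this
  linarith

theorem mem_boundary_iff [NeZero k] (t : I^(Fin k)) :
    t ∈ Cube.boundary (Fin k) ↔ dep (ctr t) = 0 := by
  rw [dep, sub_eq_zero]
  constructor
  · rintro ⟨i, hi⟩
    refine le_antisymm ?_ (norm_ctr_le t)
    refine le_trans (le_of_eq ?_) (norm_le_pi_norm (ctr t) i)
    rcases hi with hi | hi <;> (simp [ctr, hi]; try norm_num)
  · intro h
    obtain ⟨i, hi⟩ := Finite.exists_max fun i => ‖ctr t i‖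
    have h1 : ‖ctr t i‖ = 1 := by
      refine le_antisymm ((norm_le_pi_norm _ i).trans h.ge) ?_
      rw [h]
      exact (pi_norm_le_iff_of_nonneg (norm_nonneg _)).2 hi
    refine ⟨i, ?_⟩
    rw [Real.norm_eq_abs, abs_eq zero_le_one] at h1
    simp only [ctr] at h1
    rcases h1 with h1 | h1
    · right; apply Subtype.ext; rw [Set.Icc.coe_one]; linarith
    · left; apply Subtype.ext; rw [Set.Icc.coe_zero]; linarith

theorem vec_zero (y : Fin k → ℝ) : vec y 0 = (sq y - dep y ^ 2) / (sq y + dep y ^ 2) := rfl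

theorem vec_succ (y : Fin k → ℝ) (i : Fin k) :
    vec y i.succ = 2 * dep y * y i / (sq y + dep y ^ 2) := rfl

theorem vec_of_dep_eq_zero {y : Fin k → ℝ} (h : dep y = 0) :
    vec y = EuclideanSpace.single 0 1 := by
  have hd := den_pos y
  have h0 : sq y ≠ 0 := by
    rw [h] at hd
    intro h'
    simp [h'] at hd
  ext j
  refine Fin.cases ?_ (fun i => ?_) j
  · rw [vec_zero, h]; simp [h0]
  · rw [vec_succ, h]; simp

theorem dep_eq_zero_of_vec {y : Fin k → ℝ} (h : vec y 0 = 1) : dep y = 0 := by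
  have hd := den_pos y
  rw [vec_zero, div_eq_one_iff_eq hd.ne'] at h
  have : dep y ^ 2 = 0 := by linarith
  simpa using this

theorem vec_ratio {y : Fin k → ℝ} (h : dep y ≠ 0) (i : Fin k) :
    vec y i.succ / (1 - vec y 0) = y i / dep y := by
  have hd := (den_pos y).ne'
  have : 1 - vec y 0 = 2 * dep y ^ 2 / (sq y + dep y ^ 2) := by
    rw [vec_zero]; field_simp; ring
  rw [this, vec_succ]
  field_simp

theorem vec_inj {y y' : Fin k → ℝ} (h0 : 0 < dep y) (h0' : 0 < dep y') (h : vec y = vec y') :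
    y = y' := by
  have key : dep y' • y = dep y • y' := by
    ext i
    have := vec_ratio h0.ne' i
    rw [h, vec_ratio h0'.ne' i, div_eq_div_iff h0'.ne' h0.ne'] at this
    simp only [Pi.smul_apply, smul_eq_mul]
    linarith
  have hn := congrArg norm key
  rw [norm_smul, norm_smul, Real.norm_of_nonneg h0.le, Real.norm_of_nonneg h0'.le] at hn
  have hy : ‖y‖ = 1 - dep y := by simp [dep]
  have hy' : ‖y'‖ = 1 - dep y' := by simp [dep]
  have hdd : dep y = dep y' := by rw [hy, hy'] at hn; linarith
  rw [hdd] at key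
  exact smul_right_injective _ h0'.ne' key

theorem exists_vec (v : EuclideanSpace ℝ (Fin (k + 1))) (hv : ‖v‖ = 1)
    (hne : v ≠ EuclideanSpace.single 0 1) : ∃ t : I^(Fin k), vec (ctr t) = v := by
  rw [EuclideanSpace.norm_eq, Real.sqrt_eq_one, Fin.sum_univ_succ] at hv
  simp only [Real.norm_eq_abs, sq_abs] at hv
  have hs : 0 ≤ ∑ i : Fin k, v i.succ ^ 2 := Finset.sum_nonneg fun _ _ => _root_.sq_nonneg _
  have hlt : v 0 < 1 := by
    refine lt_of_le_of_ne (by nlinarith) fun h => hne ?_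
    have h0 : ∑ i : Fin k, v i.succ ^ 2 = 0 := by rw [h] at hv; linarith
    rw [Finset.sum_eq_zero_iff_of_nonneg fun _ _ => _root_.sq_nonneg _] at h0
    ext j
    refine Fin.cases ?_ (fun i => ?_) j
    · simp [h]
    · simpa using h0 i (Finset.mem_univ _)
  have hpos : 0 < 1 - v 0 := by linarith
  set z : Fin k → ℝ := fun i => v i.succ / (1 - v 0) with hz
  have hN : 0 < 1 + ‖z‖ := by positivity
  have hzi : ∀ i, |z i| ≤ ‖z‖ := fun i => norm_le_pi_norm z i
  have hmem : ∀ i, (z i / (1 + ‖z‖) + 1) / 2 ∈ I := by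
    intro i
    have h1 := abs_le.1 (hzi i)
    have h2 : -1 ≤ z i / (1 + ‖z‖) := by rw [le_div_iff₀ hN]; linarith
    have h3 : z i / (1 + ‖z‖) ≤ 1 := by rw [div_le_iff₀ hN]; linarith
    constructor <;> linarith
  refine ⟨fun i => ⟨_, hmem i⟩, ?_⟩
  have hc : ctr (fun i => (⟨_, hmem i⟩ : I)) = (1 + ‖z‖)⁻¹ • z := by
    ext i
    simp only [ctr, Pi.smul_apply, smul_eq_mul]
    field_simp
    ring
  rw [hc]
  have hdep : dep ((1 + ‖z‖)⁻¹ • z) = (1 + ‖z‖)⁻¹ := by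
    rw [dep, norm_smul, Real.norm_of_nonneg (by positivity)]
    field_simp
    ring
  have hsq : sq ((1 + ‖z‖)⁻¹ • z) = (1 + ‖z‖)⁻¹ ^ 2 * ((1 + v 0) / (1 - v 0)) := by
    simp only [sq, Pi.smul_apply, smul_eq_mul, mul_pow, ← Finset.mul_sum, hz, div_pow,
      ← Finset.sum_div]
    rw [show ∑ i : Fin k, v i.succ ^ 2 = (1 - v 0) * (1 + v 0) by linarith]
    field_simp
  have hden : sq ((1 + ‖z‖)⁻¹ • z) + dep ((1 + ‖z‖)⁻¹ • z) ^ 2 =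
      (1 + ‖z‖)⁻¹ ^ 2 * (2 / (1 - v 0)) := by
    rw [hsq, hdep]; field_simp; ring
  ext j
  refine Fin.cases ?_ (fun i => ?_) j
  · rw [vec_zero, hden, hsq, hdep]
    field_simp
    ring
  · rw [vec_succ, hden, hdep]
    simp only [Pi.smul_apply, smul_eq_mul, hz]
    field_simp

end Collapse

/-- The quotient map `[0,1]^k → S^k` which collapses the boundary of the cube to the base point. -/
noncomputable def collapse (k : ℕ) : C(I^(Fin k), (sphere.{u} k).carrier) where
  toFun t := ⟨⟨Collapse.vec (Collapse.ctr t), Collapse.vec_mem _⟩⟩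
  continuous_toFun := by
    have : Continuous (Collapse.ctr (k := k)) := by unfold Collapse.ctr; fun_prop
    exact continuous_uliftUp.comp ((Collapse.continuous_vec.comp this).subtype_mk _)

section Sphere

variable {k : ℕ} [NeZero k]

theorem collapse_eq_pt_iff (t : I^(Fin k)) :
    collapse.{u} k t = (sphere.{u} k).pt ↔ t ∈ Cube.boundary (Fin k) := by
  rw [Collapse.mem_boundary_iff]
  constructor
  · intro h
    have h' : Collapse.vec (Collapse.ctr t) = EuclideanSpace.single 0 1 :=
      congrArg (fun a => a.down.1) h
    exact Collapse.dep_eq_zero_of_vec (by rw [h']; simp)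
  · intro h
    exact congrArg ULift.up (Subtype.ext (Collapse.vec_of_dep_eq_zero h))

theorem collapse_eq_iff (t t' : I^(Fin k)) : collapse.{u} k t = collapse.{u} k t' ↔
    t = t' ∨ (t ∈ Cube.boundary (Fin k) ∧ t' ∈ Cube.boundary (Fin k)) := by
  constructor
  · intro h
    by_cases ht : t ∈ Cube.boundary (Fin k)
    · exact Or.inr ⟨ht, (collapse_eq_pt_iff t').1 (h ▸ (collapse_eq_pt_iff t).2 ht)⟩
    · have ht' : t' ∉ Cube.boundary (Fin k) := fun h' =>
        ht ((collapse_eq_pt_iff t).1 (h.trans ((collapse_eq_pt_iff t').2 h')))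
      rw [Collapse.mem_boundary_iff] at ht ht'
      refine Or.inl (Collapse.ctr_injective (Collapse.vec_inj
        (lt_of_le_of_ne (Collapse.dep_nonneg t) (Ne.symm ht))
        (lt_of_le_of_ne (Collapse.dep_nonneg t') (Ne.symm ht')) ?_))
      exact congrArg (fun a => a.down.1) h
  · rintro (rfl | ⟨h, h'⟩)
    · rfl
    · rw [(collapse_eq_pt_iff t).2 h, (collapse_eq_pt_iff t').2 h']

theorem collapse_surjective : Function.Surjective (collapse.{u} k) := by
  rintro ⟨⟨v, hv⟩⟩
  by_cases h : v = EuclideanSpace.single 0 1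
  · subst h
    exact ⟨fun _ => 0, (collapse_eq_pt_iff _).2 ⟨0, Or.inl rfl⟩⟩
  · obtain ⟨t, ht⟩ := Collapse.exists_vec v (by simpa using hv) h
    exact ⟨t, congrArg ULift.up (Subtype.ext ht)⟩

instance : T2Space (sphere.{u} k).carrier :=
  inferInstanceAs (T2Space (ULift (Metric.sphere (0 : EuclideanSpace ℝ (Fin (k + 1))) 1)))

theorem collapse_isQuotientMap : IsQuotientMap (collapse.{u} k) :=
  (collapse k).continuous.isClosedMap.isQuotientMap (collapse k).continuous collapse_surjective

variable {P : PSpace.{u}}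

/-- A pointed map defined on `S^k`, as a map of the cube sending the boundary to the base point. -/
noncomputable def toLoop (f : PMap (sphere.{u} k) P) : Ω^ (Fin k) P.carrier P.pt :=
  ⟨f.1.comp (collapse k), fun t ht => by
    rw [ContinuousMap.comp_apply, (collapse_eq_pt_iff t).2 ht, f.2]⟩

/-- The pointed map defined on `S^k` with a given composite with `collapse`. -/
noncomputable def ofLoop (g : Ω^ (Fin k) P.carrier P.pt) : PMap (sphere.{u} k) P :=
  ⟨collapse_isQuotientMap.lift g.1 fun t t' h => by
    rcases (collapse_eq_iff t t').1 h with rfl | ⟨h, h'⟩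
    · rfl
    · exact (g.2 t h).trans (g.2 t' h').symm, by
    obtain ⟨t, ht⟩ := collapse_surjective (sphere.{u} k).pt
    have := DFunLike.congr_fun (IsQuotientMap.lift_comp collapse_isQuotientMap g.1 fun t t' h => by
      rcases (collapse_eq_iff t t').1 h with rfl | ⟨h, h'⟩
      · rfl
      · exact (g.2 t h).trans (g.2 t' h').symm) t
    rw [← ht]
    exact this.trans (g.2 t ((collapse_eq_pt_iff t).1 ht))⟩

theorem toLoop_ofLoop (g : Ω^ (Fin k) P.carrier P.pt) : toLoop (ofLoop g) = g :=
  Subtype.ext (IsQuotientMap.lift_comp collapse_isQuotientMap g.1 _)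

theorem toLoop_homotopic_iff (f g : PMap (sphere.{u} k) P) :
    GenLoop.Homotopic (toLoop f) (toLoop g) ↔ f.1.HomotopicRel g.1 {(sphere.{u} k).pt} := by
  constructor
  · rintro ⟨F⟩
    have hF : ∀ s t t', collapse.{u} k t = collapse.{u} k t' → F (s, t) = F (s, t') := by
      intro s t t' h
      rcases (collapse_eq_iff t t').1 h with rfl | ⟨ht, ht'⟩
      · rfl
      · rw [F.eq_fst s ht, F.eq_fst s ht']
        exact ((toLoop f).2 t ht).trans ((toLoop f).2 t' ht').symm
    let G : I × (sphere.{u} k).carrier → P.carrier :=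
      fun a => F (a.1, Function.surjInv collapse_surjective a.2)
    have hG : ∀ s t, G (s, collapse k t) = F (s, t) := fun s t =>
      hF s _ _ (Function.surjInv_eq collapse_surjective _)
    have hcont : Continuous G := by
      refine collapse_isQuotientMap.continuous_lift_prod_right ?_
      simp only [hG]
      exact F.continuous
    refine ⟨⟨⟨⟨G, hcont⟩, fun a => ?_, fun a => ?_⟩, fun s a ha => ?_⟩⟩
    · obtain ⟨t, rfl⟩ := collapse_surjective a
      exact (hG 0 t).trans (F.apply_zero t)
    · obtain ⟨t, rfl⟩ := collapse_surjective a
      exact (hG 1 t).trans (F.apply_one t)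
    · obtain ⟨t, rfl⟩ := collapse_surjective a
      exact (hG s t).trans (F.eq_fst s ((collapse_eq_pt_iff t).1 ha))
  · rintro ⟨F⟩
    refine ⟨⟨F.toHomotopy.compContinuousMap (collapse k), fun s t ht => ?_⟩⟩
    exact F.eq_fst s ((collapse_eq_pt_iff t).2 ht)

/-- The pointed homotopy classes of maps `S^k → P` are the elements of `π_k(P)`. -/
noncomputable def sphereEquiv (P : PSpace.{u}) :
    (sphere.{u} k ⟶ P) ≃ HomotopyGroup (Fin k) P.carrier P.pt where
  toFun := Quotient.map toLoop fun f g h => (toLoop_homotopic_iff f g).2 h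
  invFun := Quotient.map ofLoop fun f g h => (toLoop_homotopic_iff _ _).1 (by
    rwa [toLoop_ofLoop, toLoop_ofLoop])
  left_inv := by
    rintro ⟨f⟩
    refine Quotient.sound ((toLoop_homotopic_iff _ _).1 ?_)
    rw [toLoop_ofLoop]
  right_inv := by
    rintro ⟨g⟩
    exact congrArg (Quotient.mk _) (toLoop_ofLoop g)

/-- The sum `a + b` of two pointed homotopy classes of maps `S^k → P`: first `a`, then `b`, along
the first coordinate of the cube. (Mathlib's product `y * x` in the homotopy group is `x` followed
by `y`, see `sphereEquiv_concat`.) -/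
noncomputable def concat (a b : sphere.{u} k ⟶ P) : sphere.{u} k ⟶ P :=
  (sphereEquiv P).symm (sphereEquiv P b * sphereEquiv P a)

theorem sphereEquiv_concat (f g : PMap (sphere.{u} k) P) :
    sphereEquiv P (concat f.cls g.cls) =
      Quotient.mk _ (GenLoop.transAt (0 : Fin k) (toLoop f) (toLoop g)) :=
  ((sphereEquiv P).apply_symm_apply _).trans HomotopyGroup.mul_spec

theorem concat_cls (f g : PMap (sphere.{u} k) P) :
    concat f.cls g.cls = (ofLoop (GenLoop.transAt (0 : Fin k) (toLoop f) (toLoop g))).cls := by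
  refine (sphereEquiv P).injective ((sphereEquiv_concat f g).trans ?_)
  exact congrArg (Quotient.mk _) (toLoop_ofLoop _).symm

theorem concat_comp {Q : PSpace.{u}} (a b : sphere.{u} k ⟶ P) (h : P ⟶ Q) :
    concat a b ≫ h = concat (a ≫ h) (b ≫ h) := by
  obtain ⟨f, rfl⟩ := Quotient.exists_rep a
  obtain ⟨g, rfl⟩ := Quotient.exists_rep b
  obtain ⟨r, rfl⟩ := Quotient.exists_rep h
  change concat f.cls g.cls ≫ r.cls = concat (f.comp r).cls (g.comp r).cls
  rw [concat_cls, concat_cls]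
  refine congrArg (Quotient.mk _) (Subtype.ext (ContinuousMap.ext fun a => ?_))
  obtain ⟨t, rfl⟩ := collapse_surjective a
  have h₁ := GenLoop.ext_iff.1
    (toLoop_ofLoop (GenLoop.transAt (0 : Fin k) (toLoop f) (toLoop g))) t
  have h₂ := GenLoop.ext_iff.1
    (toLoop_ofLoop (GenLoop.transAt (0 : Fin k) (toLoop (f.comp r)) (toLoop (g.comp r)))) t
  refine (congrArg r.1 h₁).trans (Eq.trans ?_ h₂.symm)
  simp only [GenLoop.transAt, GenLoop.coe_copy]
  split_ifs <;> rfl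

/-- The sum of two `S*`-morphisms `(S^k, *) → 𝐗`: the morphisms `f^n_λ + g^n_λ`. -/
noncomputable def StarMor.add {X : InvSystem.{u} PSpace.{u}}
    (f g : StarMor (rudimentary (sphere.{u} k)) X) : StarMor (rudimentary (sphere.{u} k)) X where
  idx _ := PUnit.unit
  mor n l := concat (f.mor n l) (g.mor n l)
  comm {l l'} h := by
    obtain ⟨_, _, _, N, H⟩ := f.comm h
    obtain ⟨_, _, _, M, H'⟩ := g.comm h
    have key : ∀ (x : sphere.{u} k ⟶ X.obj l), 𝟙 (sphere.{u} k) ≫ x = x := Category.id_comp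
    refine ⟨PUnit.unit, le_rfl, le_rfl, max N M, fun n hn => ?_⟩
    have h₁ : f.mor n l' ≫ X.bond h = f.mor n l :=
      (key _).symm.trans ((H n (le_of_max_le_left hn)).trans (key _))
    have h₂ : g.mor n l' ≫ X.bond h = g.mor n l :=
      (key _).symm.trans ((H' n (le_of_max_le_right hn)).trans (key _))
    refine (key _).trans (Eq.trans ?_ (key _).symm)
    exact (concat_comp _ _ _).trans (congrArg₂ concat h₁ h₂)

end Sphere

end CoarseShape

open CoarseShape

namespace CoarseShape

/-! The algebra and the topology are formal once two facts of shape theory are available: the sphere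
is a polyhedron (`hPol_sphere`), and every pointed space has an expansion (`exists_expansion`). The
second cannot be avoided, since without an expansion there would be no coarse shape morphisms into
`X` at all, and hence no unit.

Given an expansion `p`, every coarse shape morphism from the sphere has a unique representative in
`pro*` over `p` (`Sh.equivPro`). Two `S*`-morphisms from the sphere are equivalent exactly when
their terms eventually agree at each index. Each set of terms is a copy of a homotopy group, and
composition with a morphism is a homomorphism (`postcompHom`), so termwise addition descends to the
classes. The set `V_λ^F` consists of the classes whose terms at `λ` eventually agree with those of
`F` (`Sh.comp_proj_eq_iff`). This is a congruence for each `λ`, and it gets finer as `λ` grows;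
hence the `V_λ^F` are a basis of a group topology. The natural morphisms between expansions respect
sums and transport these congruences, which makes both structures independent of `p`.

For the existence of an expansion, the maps from `X` to polyhedra must form a filtered category with
only a set of objects. The required products and homotopy equalizers are not formed among polyhedra,
but among open subsets of normed spaces, where they are easy. The two classes are homotopy retracts
of each other: an open set retracts from the nerve of a cover by small balls
(`IsOpenInNormed.exists_retract`), and `|K|` retracts from a neighbourhood of its image in the
bounded functions on the vertices (`exists_isOpenInNormed`). Size is bounded because a map from `X`
meets the carriers of at most `X × ℕ` many vertices (`Realization.exists_factor`).

The sphere is the radial projection of the boundary of a simplex (`SimplexBoundary.exists_inverse`).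
-/

theorem PMap.cls_eq_of_homotopy {X Y : PSpace.{u}} {f g : PMap X Y}
    (H : X.carrier × I → Y.carrier) (hH : Continuous H) (h0 : ∀ x, H (x, 0) = f.1 x)
    (h1 : ∀ x, H (x, 1) = g.1 x) (hpt : ∀ t, H (X.pt, t) = Y.pt) : f.cls = g.cls := by
  refine Quotient.sound ⟨⟨⟨⟨fun a => H (a.2, a.1), by fun_prop⟩, h0, h1⟩, ?_⟩⟩
  rintro t x rfl
  exact (hpt t).trans f.2.symm

theorem PMap.exists_homotopy_of_cls_eq {X Y : PSpace.{u}} {f g : PMap X Y} (h : f.cls = g.cls) :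
    ∃ H : X.carrier × I → Y.carrier, Continuous H ∧ (∀ x, H (x, 0) = f.1 x) ∧
      (∀ x, H (x, 1) = g.1 x) ∧ ∀ t, H (X.pt, t) = Y.pt := by
  obtain ⟨F⟩ := Quotient.exact h
  exact ⟨fun a => F (a.2, a.1), by fun_prop, fun x => F.apply_zero x, fun x => F.apply_one x,
    fun t => (F.eq_fst t rfl).trans f.2⟩

theorem PMap.comp_cls {X Y Z : PSpace.{u}} (f : PMap X Y) (g : PMap Y Z) :
    f.cls ≫ g.cls = (f.comp g).cls := rfl

theorem PMap.exists_cls {X Y : PSpace.{u}} (h : X ⟶ Y) : ∃ f : PMap X Y, f.cls = h :=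
  Quotient.exists_rep h

/-! ### Geometric realizations: continuity criteria and barycentric normalisation -/

namespace Realization

variable {V : Type u} {K : AbstractSimplicialComplex V}

theorem ext {b b' : Realization K} (h : ∀ v, b.1 v = b'.1 v) : b = b' :=
  Subtype.ext (funext h)

theorem continuous_incl (s : K.faces) : Continuous (incl K s) :=
  continuous_iff_coinduced_le.2 (le_iSup (fun s : K.faces =>
    TopologicalSpace.coinduced (Realization.incl K s) inferInstance) s)

theorem continuous_dom {Y : Type*} [TopologicalSpace Y] {f : Realization K → Y}
    (h : ∀ s : K.faces, Continuous (f ∘ incl K s)) : Continuous f :=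
  continuous_iSup_dom.2 fun s => continuous_coinduced_dom.2 (h s)

theorem continuous_coord (v : V) : Continuous fun b : Realization K => b.1 v :=
  continuous_dom fun _ => (continuous_apply v).comp continuous_subtype_val

/-- The product with `I` keeps the weak topology because `I` is locally compact: curry `f` to a map
`|K| → C(I, Y)`, test that one on the simplices, and evaluate. This makes homotopies on `|K|`
checkable simplex by simplex. -/
theorem continuous_dom_prod {Y : Type*} [TopologicalSpace Y] {f : Realization K × I → Y}
    (h : ∀ s : K.faces, Continuous fun a : closedSimplex s.1 × I => f (incl K s a.1, a.2)) :
    Continuous f := by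
  have hb : ∀ b, Continuous fun t => f (b, t) := by
    rintro ⟨b, s, hs, hb⟩
    exact (h ⟨s, hs⟩).comp (Continuous.prodMk_right (⟨b, hb⟩ : closedSimplex s))
  let g : Realization K → C(I, Y) := fun b => ⟨fun t => f (b, t), hb b⟩
  have hg : Continuous g := continuous_dom fun s =>
    ContinuousMap.continuous_of_continuous_uncurry _ (h s)
  have : f = fun a => g a.1 a.2 := rfl
  rw [this]
  fun_prop

theorem nonneg (b : Realization K) (v : V) : 0 ≤ b.1 v := by
  obtain ⟨s, _, hb⟩ := b.2
  exact hb.1 v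

theorem le_one_of_mem {s : Finset V} {b : V → ℝ} (hb : b ∈ closedSimplex s) (v : V) :
    b v ≤ 1 := by
  by_cases h : v ∈ s
  · rw [← hb.2.2]
    exact Finset.single_le_sum (fun i _ => hb.1 i) h
  · rw [hb.2.1 v h]
    exact zero_le_one

theorem le_one (b : Realization K) (v : V) : b.1 v ≤ 1 := by
  obtain ⟨s, _, hb⟩ := b.2
  exact le_one_of_mem hb v

theorem exists_pos_of_mem {s : Finset V} {b : V → ℝ} (hb : b ∈ closedSimplex s) :
    ∃ v ∈ s, 0 < b v := by
  by_contra! h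
  have := Finset.sum_nonpos h
  rw [hb.2.2] at this
  linarith

theorem isClosed_closedSimplex (s : Finset V) : IsClosed (closedSimplex s) := by
  have : closedSimplex s = (⋂ v, {b : V → ℝ | 0 ≤ b v}) ∩
      ((⋂ v, ⋂ (_ : v ∉ s), {b : V → ℝ | b v = 0}) ∩ {b | ∑ v ∈ s, b v = 1}) := by
    ext b
    simp [closedSimplex]
  rw [this]
  refine (isClosed_iInter fun v => isClosed_le continuous_const (continuous_apply v)).inter
    ((isClosed_iInter fun v => isClosed_iInter fun _ =>
      isClosed_eq (continuous_apply v) continuous_const).inter (isClosed_eq (by fun_prop)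
        continuous_const))

theorem mem_closedSimplex_of_subset {s t : Finset V} {b : V → ℝ} (hb : b ∈ closedSimplex s)
    (hst : s ⊆ t) : b ∈ closedSimplex t :=
  ⟨hb.1, fun v hv => hb.2.1 v fun h => hv (hst h), by
    rw [← hb.2.2]
    exact (Finset.sum_subset hst fun v _ hv => hb.2.1 v hv).symm⟩

/-- The carrier of a point is a face. -/
theorem exists_carrier (b : Realization K) :
    ∃ s ∈ K.faces, b.1 ∈ closedSimplex s ∧ ∀ v, v ∈ s ↔ b.1 v ≠ 0 := by
  classical
  obtain ⟨s, hs, hb⟩ := b.2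
  have hsub : s.filter (fun v => b.1 v ≠ 0) ⊆ s := Finset.filter_subset _ _
  have hiff : ∀ v, v ∈ s.filter (fun v => b.1 v ≠ 0) ↔ b.1 v ≠ 0 := fun v => by
    rw [Finset.mem_filter, and_iff_right_iff_imp]
    intro h
    by_contra h'
    exact h (hb.2.1 v h')
  refine ⟨s.filter fun v => b.1 v ≠ 0, (K.isRelLowerSet_faces hs).2 hsub ?_,
    ⟨hb.1, fun v hv => ?_, ?_⟩, hiff⟩
  · obtain ⟨v, _, hv⟩ := exists_pos_of_mem hb
    exact ⟨v, (hiff v).2 hv.ne'⟩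
  · by_contra h
    exact hv ((hiff v).2 h)
  · rw [Finset.sum_filter_ne_zero, hb.2.2]

/-- A map to a polyhedron which locally has finite support is continuous as soon as its
barycentric coordinates are. -/
theorem continuous_of_coord {Y : Type*} [TopologicalSpace Y] {f : Y → Realization K}
    (hf : ∀ v, Continuous fun y => (f y).1 v)
    (hfin : ∀ y, ∃ t : Finset V, ∀ᶠ y' in 𝓝 y, ∀ v, v ∉ t → (f y').1 v = 0) :
    Continuous f := by
  classical
  rw [continuous_iff_continuousAt]
  intro y
  obtain ⟨t, ht⟩ := hfin y
  obtain ⟨U, hU, hUo, hyU⟩ := eventually_nhds_iff.1 ht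
  suffices h : ContinuousOn f U from h.continuousAt (hUo.mem_nhds hyU)
  rw [continuousOn_iff_continuous_domRestrict]
  -- Over `U` the values lie in the finitely many faces contained in `t`. Their preimages form a
  -- finite closed cover, and on each of them `f` factors through a closed simplex, where
  -- coordinatewise continuity suffices.
  let A : {s // s ∈ t.powerset ∧ s ∈ K.faces} → Set U := fun s => {y | (f y).1 ∈ closedSimplex s.1}
  have : Finite {s // s ∈ t.powerset ∧ s ∈ K.faces} :=
    ((Finset.finite_toSet t.powerset).subset fun s hs => hs.1).to_subtype
  have hcf : Continuous fun y : U => (f y).1 :=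
    continuous_pi fun v => (hf v).comp continuous_subtype_val
  refine (locallyFinite_of_finite A).continuous ?_
    (fun s => (isClosed_closedSimplex s.1).preimage hcf) fun s => ?_
  · refine Set.eq_univ_of_forall fun y => ?_
    obtain ⟨s, hs, hb, hiff⟩ := exists_carrier (f y)
    refine Set.mem_iUnion.2 ⟨⟨s, Finset.mem_powerset.2 fun v hv => ?_, hs⟩, hb⟩
    by_contra h
    exact (hiff v).1 hv (hU y y.2 v h)
  · rw [continuousOn_iff_continuous_domRestrict]
    exact (continuous_incl ⟨s.1, s.2.2⟩).comp
      (((hcf.comp continuous_subtype_val).subtype_mk fun a => a.2) :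
        Continuous fun a : A s => (⟨(f a.1).1, a.2⟩ : closedSimplex s.1))

/-- Normalisation of a nonnegative function with support in a face. -/
theorem normalize_mem {s : Finset V} {ψ : V → ℝ} (h0 : ∀ v, 0 ≤ ψ v) (hs : ∀ v, v ∉ s → ψ v = 0)
    (hpos : ∃ v, 0 < ψ v) : (fun v => ψ v / ∑ᶠ w, ψ w) ∈ closedSimplex s := by
  have hsum : ∑ᶠ w, ψ w = ∑ w ∈ s, ψ w :=
    finsum_eq_sum_of_support_subset _ fun v hv => by
      by_contra h
      exact hv (hs v h)
  obtain ⟨v, hv⟩ := hpos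
  have hvs : v ∈ s := by
    by_contra h
    exact hv.ne' (hs v h)
  have : 0 < ∑ w ∈ s, ψ w := Finset.sum_pos' (fun i _ => h0 i) ⟨v, hvs, hv⟩
  rw [hsum]
  refine ⟨fun v => div_nonneg (h0 v) this.le, fun v hv => by simp [hs v hv], ?_⟩
  rw [← Finset.sum_div, div_self this.ne']

/-- A locally finite family of nonnegative functions, with supports in faces of `K` and without
common zeros, gives a map to `|K|`. -/
theorem exists_normalize (K : AbstractSimplicialComplex V) {Y : Type*} [TopologicalSpace Y]
    (ψ : Y → V → ℝ) (h0 : ∀ y v, 0 ≤ ψ y v) (hpos : ∀ y, ∃ v, 0 < ψ y v)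
    (hψ : ∀ v, Continuous fun y => ψ y v)
    (hface : ∀ y, ∃ s ∈ K.faces, ∀ v, v ∉ s → ψ y v = 0)
    (hfin : ∀ y, ∃ t : Finset V, ∀ᶠ y' in 𝓝 y, ∀ v, v ∉ t → ψ y' v = 0) :
    ∃ f : C(Y, Realization K), ∀ y v, (f y).1 v = ψ y v / ∑ᶠ w, ψ y w := by
  choose s hsK hs using hface
  have hc : Continuous fun y => ∑ᶠ w, ψ y w := by
    refine continuous_finsum hψ fun y => ?_
    obtain ⟨t, ht⟩ := hfin y
    refine ⟨_, ht, t.finite_toSet.subset ?_⟩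
    rintro v ⟨y', hy', hy''⟩
    by_contra h
    exact hy' (hy'' v h)
  have hne : ∀ y, ∑ᶠ w, ψ y w ≠ 0 := fun y h => by
    have := (normalize_mem (h0 y) (hs y) (hpos y)).2.2
    simp [h] at this
  refine ⟨⟨fun y => ⟨_, s y, hsK y, normalize_mem (h0 y) (hs y) (hpos y)⟩,
    continuous_of_coord (fun v => (hψ v).div hc hne) fun y => ?_⟩, fun _ _ => rfl⟩
  obtain ⟨t, ht⟩ := hfin y
  exact ⟨t, ht.mono fun y' h v hv => by simp [h v hv]⟩

end Realization

theorem closedSimplex_convex {V : Type u} {s : Finset V} {a b : V → ℝ} (ha : a ∈ closedSimplex s)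
    (hb : b ∈ closedSimplex s) (t : I) :
    (fun v => (1 - (t : ℝ)) * a v + t * b v) ∈ closedSimplex s := by
  have h0 := t.2.1
  have h1 : 0 ≤ 1 - (t : ℝ) := sub_nonneg.2 t.2.2
  refine ⟨fun v => add_nonneg (mul_nonneg h1 (ha.1 v)) (mul_nonneg h0 (hb.1 v)), fun v hv => ?_, ?_⟩
  · simp [ha.2.1 v hv, hb.2.1 v hv]
  · rw [Finset.sum_add_distrib, ← Finset.mul_sum, ← Finset.mul_sum, ha.2.2, hb.2.2]
    ring

/-! ### Open subsets of normed spaces as homotopy retracts of nerves -/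

/-- Pointed spaces homeomorphic to an open subset of a normed space. -/
def IsOpenInNormed (Z : PSpace.{u}) : Prop :=
  ∃ (E : Type u) (_ : NormedAddCommGroup E) (_ : NormedSpace ℝ E) (e : Z.carrier → E),
    IsOpenEmbedding e

section Nerve

variable {Z : Type u} (U : Z → Set Z) (hU : ∀ z, z ∈ U z)

/-- The nerve of a cover indexed by the points of the space. -/
def nerve : AbstractSimplicialComplex Z where
  faces := {s | s.Nonempty ∧ ∃ x, ∀ z ∈ s, x ∈ U z}
  isRelLowerSet_faces := fun _ ⟨hs, x, hx⟩ =>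
    ⟨hs, fun _ ht hne => ⟨hne, x, fun z hz => hx z (ht hz)⟩⟩
  singleton_mem z := ⟨Finset.singleton_nonempty z, z, fun w hw => by
    rw [Finset.mem_singleton.1 hw]
    exact hU z⟩

end Nerve

/-- Pointed open subsets of normed spaces are homotopy retracts of pointed polyhedra. -/
theorem IsOpenInNormed.exists_retract {Z : PSpace.{u}} (hZ : IsOpenInNormed Z) :
    ∃ (V : Type u) (K : AbstractSimplicialComplex V) (v : V) (s : Z ⟶ pointedPolyhedron K v)
      (r : pointedPolyhedron K v ⟶ Z), s ≫ r = 𝟙 Z := by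
  classical
  obtain ⟨E, _, _, e, he⟩ := hZ
  -- Metrizability gives the paracompactness needed for partitions of unity.
  let _ : MetricSpace Z.carrier := he.isEmbedding.comapMetricSpace e
  have hr : ∀ z, ∃ ε > 0, Metric.ball (e z) (3 * ε) ⊆ Set.range e := fun z => by
    obtain ⟨ε, hε, h⟩ := Metric.isOpen_iff.1 he.isOpen_range (e z) ⟨z, rfl⟩
    exact ⟨ε / 3, by positivity, by rwa [mul_div_cancel₀ _ three_ne_zero]⟩
  choose R hR hball using hr
  -- The second factor removes the base point from every member of the cover except its own, so that
  -- the partition of unity sends the base point to a vertex.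
  let U : Z.carrier → Set Z.carrier := fun z =>
    e ⁻¹' Metric.ball (e z) (R z) ∩ {x | x = Z.pt → z = Z.pt}
  have hUo : ∀ z, IsOpen (U z) := fun z => by
    refine (Metric.isOpen_ball.preimage he.continuous).inter ?_
    by_cases h : z = Z.pt
    · simp [h]
    · simp only [h, imp_false]
      exact isOpen_compl_singleton
  have hU : ∀ z, z ∈ U z := fun z => ⟨by simpa using hR z, fun h => h⟩
  obtain ⟨φ, hφ⟩ := PartitionOfUnity.exists_isSubordinate isClosed_univ U hUo
    fun z _ => Set.mem_iUnion.2 ⟨z, hU z⟩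
  have hφU : ∀ z x, φ z x ≠ 0 → x ∈ U z := fun z x h => hφ z (subset_tsupport _ h)
  let K := nerve U hU
  -- the key convexity property of the nerve
  have key : ∀ s ∈ K.faces, ∀ x, (∀ z ∈ s, x ∈ U z) → ∃ c : Z.carrier,
      (∀ z ∈ s, e z ∈ Metric.ball (e c) (3 * R c)) ∧ e x ∈ Metric.ball (e c) (3 * R c) := by
    rintro s ⟨hs, -⟩ x hx
    -- The vertex `c` of largest radius serves as centre: the other vertices are within `R z + R c ≤
    -- 2 * R c` of it. The ball of radius `3 * R c` is convex and lies in the image of `e`.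
    obtain ⟨c, hc, hmax⟩ := s.exists_max_image R hs
    have hxc : dist (e x) (e c) < R c := (hx c hc).1
    refine ⟨c, fun z hz => ?_, ?_⟩
    · have h1 : dist (e x) (e z) < R z := (hx z hz).1
      have h2 := hmax z hz
      have h3 := dist_triangle_left (e z) (e c) (e x)
      rw [Metric.mem_ball]
      linarith [hR c]
    · rw [Metric.mem_ball]
      linarith [hR c]
  let lin : (Z.carrier → ℝ) → E := fun b => ∑ᶠ z, b z • e z
  have lin_eq : ∀ (s : Finset Z.carrier) (b : Z.carrier → ℝ), b ∈ closedSimplex s →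
      lin b = ∑ z ∈ s, b z • e z := fun s b hb =>
    finsum_eq_sum_of_support_subset _ fun z hz => by
      by_contra h
      exact hz (by simp [hb.2.1 z h])
  have lin_mem : ∀ (s : Finset Z.carrier) (b : Z.carrier → ℝ) (C : Set E), b ∈ closedSimplex s →
      Convex ℝ C → (∀ z ∈ s, e z ∈ C) → lin b ∈ C := fun s b C hb hC h => by
    rw [lin_eq s b hb]
    exact hC.sum_mem (fun z _ => hb.1 z) hb.2.2 h
  have hrange : ∀ b : Realization K, ∃ z, e z = lin b.1 := by
    rintro ⟨b, s, hs, hb⟩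
    obtain ⟨x, hx⟩ := hs.2
    obtain ⟨c, hc, -⟩ := key s hs x hx
    exact hball c (lin_mem s b _ hb (convex_ball _ _) hc)
  choose r hr using hrange
  have hrc : Continuous r := by
    rw [he.isInducing.continuous_iff]
    refine Realization.continuous_dom fun s => ?_
    have : (e ∘ r) ∘ Realization.incl K s = fun b => ∑ z ∈ s.1, b.1 z • e z := by
      funext b
      exact (hr _).trans (lin_eq s.1 b.1 b.2)
    rw [this]
    exact continuous_finsetSum _ fun z _ =>
      ((continuous_apply z).comp continuous_subtype_val).smul continuous_const
  obtain ⟨f, hf⟩ := Realization.exists_normalize K (fun x z => φ z x) (fun x z => φ.nonneg z x)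
    (fun x => φ.exists_pos (Set.mem_univ x)) (fun z => (φ z).continuous) (fun x => by
      refine ⟨φ.finsupport x, ⟨?_, x, fun z hz => ?_⟩, fun z hz => ?_⟩
      · obtain ⟨z, hz⟩ := φ.exists_pos (Set.mem_univ x)
        exact ⟨z, (φ.mem_finsupport x).2 hz.ne'⟩
      · exact hφU z x ((φ.mem_finsupport x).1 hz)
      · by_contra h
        exact hz ((φ.mem_finsupport x).2 h))
    (fun x => ⟨φ.fintsupport x, (φ.eventually_finsupport_subset x).mono fun y hy z hz => by
      by_contra h
      exact hz (hy ((φ.mem_finsupport y).2 h))⟩)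
  have hf' : ∀ x z, (f x).1 z = φ z x := fun x z => by
    rw [hf, φ.sum_eq_one (Set.mem_univ x), div_one]
  have hpt : ∀ z, φ z Z.pt = if z = Z.pt then 1 else 0 := by
    have h0 : ∀ z, z ≠ Z.pt → φ z Z.pt = 0 := fun z hz => by
      by_contra h
      exact hz ((hφU z _ h).2 rfl)
    intro z
    split_ifs with h
    · subst h
      rw [← φ.sum_eq_one (Set.mem_univ Z.pt)]
      exact (finsum_eq_single _ _ h0).symm
    · exact h0 z h
  have hfpt : f Z.pt = Realization.vertex K Z.pt := Realization.ext fun z => by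
    rw [hf', hpt]
    simp [Realization.vertex, Pi.single_apply]
  have hlinpt : lin (f Z.pt).1 = e Z.pt := by
    have : lin (f Z.pt).1 = (f Z.pt).1 Z.pt • e Z.pt :=
      finsum_eq_single _ _ fun z hz => by rw [hf', hpt, if_neg hz, zero_smul]
    rw [this, hf', hpt, if_pos rfl, one_smul]
  have hrpt : r (Realization.vertex K Z.pt) = Z.pt := he.injective (by
    rw [hr, ← hfpt, hlinpt])
  let F : PMap Z (pointedPolyhedron K Z.pt) := ⟨f, hfpt⟩
  let G : PMap (pointedPolyhedron K Z.pt) Z := ⟨⟨r, hrc⟩, hrpt⟩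
  refine ⟨Z.carrier, K, Z.pt, F.cls, G.cls, ?_⟩
  -- The straight-line homotopy from `r ∘ f` to the identity stays in the open set, as `x` and the
  -- vertices of the carrier of `f x` lie in a common ball provided by `key`.
  have hH : ∀ a : Z.carrier × I, ∃ z, e z = (1 - (a.2 : ℝ)) • e (r (f a.1)) + (a.2 : ℝ) • e a.1 := by
    rintro ⟨x, t⟩
    obtain ⟨s, hs, hb, hiff⟩ := Realization.exists_carrier (f x)
    obtain ⟨c, hc, hxc⟩ := key s hs x fun z hz => hφU z x (by
      rw [← hf']
      exact (hiff z).1 hz)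
    refine hball c ?_
    refine (convex_ball (e c) (3 * R c)) ?_ hxc (sub_nonneg.2 t.2.2) t.2.1 (sub_add_cancel _ _)
    rw [hr]
    exact lin_mem s _ _ hb (convex_ball _ _) hc
  choose H hH using hH
  refine PMap.cls_eq_of_homotopy (f := F.comp G) (g := ⟨ContinuousMap.id _, rfl⟩) H ?_ ?_ ?_ ?_
  · rw [he.isInducing.continuous_iff]
    have : e ∘ H = fun a => (1 - (a.2 : ℝ)) • e (r (f a.1)) + (a.2 : ℝ) • e a.1 := funext hH
    rw [this]
    have := he.continuous
    fun_prop
  · intro x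
    refine he.injective ((hH _).trans ?_)
    simp
    rfl
  · intro x
    refine he.injective ((hH _).trans ?_)
    simp
  · intro t
    refine he.injective ((hH _).trans ?_)
    simp only [hfpt, hrpt]
    rw [← add_smul, sub_add_cancel, one_smul]

/-! ### Polyhedra as homotopy retracts of open sets of bounded functions -/

namespace Realization

variable {V S : Type u} {K : AbstractSimplicialComplex V}

theorem eq_vertex {b : Realization K} {v : V} (hb : b.1 ∈ closedSimplex {v}) :
    b = vertex K v := by
  refine ext fun w => ?_
  by_cases h : w = v
  · subst h
    have := hb.2.2
    rw [Finset.sum_singleton] at this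
    rw [this]
    simp [vertex]
  · rw [hb.2.1 w (by simpa using h)]
    simp [vertex, h]

theorem vertex_mem (v : V) : (vertex K v).1 ∈ closedSimplex {v} := by
  refine ⟨nonneg _, fun w hw => ?_, ?_⟩
  · simp [vertex, show w ≠ v by simpa using hw]
  · simp [vertex]

/-- The complex induced on `S` by an injection `S → V`. -/
def comap (K : AbstractSimplicialComplex V) (α : S ↪ V) : AbstractSimplicialComplex S where
  faces := {s | s.map α ∈ K.faces}
  isRelLowerSet_faces := fun _ hs => ⟨Finset.map_nonempty.1 (K.isRelLowerSet_faces hs).1,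
    fun _ ht hne => (K.isRelLowerSet_faces hs).2 (Finset.map_subset_map.2 ht) (hne.map)⟩
  singleton_mem v := by
    change Finset.map α {v} ∈ K.faces
    rw [Finset.map_singleton]
    exact K.singleton_mem _

theorem extend_mem {α : S ↪ V} {s : Finset S} {b : S → ℝ} (hb : b ∈ closedSimplex s) :
    Function.extend α b 0 ∈ closedSimplex (s.map α) := by
  refine ⟨fun v => ?_, fun v hv => ?_, ?_⟩
  · by_cases h : ∃ i, α i = v
    · obtain ⟨i, rfl⟩ := h
      rw [α.injective.extend_apply]
      exact hb.1 i
    · rw [Function.extend_apply' _ _ _ h]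
      exact le_rfl
  · by_cases h : ∃ i, α i = v
    · obtain ⟨i, rfl⟩ := h
      rw [α.injective.extend_apply]
      exact hb.2.1 i fun hi => hv (Finset.mem_map_of_mem α hi)
    · rw [Function.extend_apply' _ _ _ h]
      rfl
  · rw [Finset.sum_map, ← hb.2.2]
    exact Finset.sum_congr rfl fun i _ => α.injective.extend_apply _ _ _

/-- The inclusion of the realization of an induced complex. -/
noncomputable def extendMap (K : AbstractSimplicialComplex V) (α : S ↪ V) :
    C(Realization (comap K α), Realization K) where
  toFun b := ⟨Function.extend α b.1 0, by
    obtain ⟨s, hs, hb⟩ := b.2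
    exact ⟨s.map α, hs, extend_mem hb⟩⟩
  continuous_toFun := continuous_dom fun s => by
    refine (continuous_incl (K := K) ⟨s.1.map α, s.2⟩).comp
      (Continuous.subtype_mk (f := fun b : closedSimplex s.1 => Function.extend α b.1 0)
        (continuous_pi fun v => ?_) fun b => extend_mem b.2)
    by_cases h : ∃ i, α i = v
    · obtain ⟨i, rfl⟩ := h
      simp only [α.injective.extend_apply]
      exact (continuous_apply i).comp continuous_subtype_val
    · simp only [Function.extend_apply' _ _ _ h]
      exact continuous_const

theorem extendMap_vertex (K : AbstractSimplicialComplex V) (α : S ↪ V) (i : S) :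
    extendMap K α (vertex _ i) = vertex K (α i) :=
  eq_vertex (by
    rw [← Finset.map_singleton]
    exact extend_mem (vertex_mem i))

/-- The inclusion of `|K|` into the space of bounded functions on the vertices. -/
noncomputable def toBdd (b : Realization K) : lp (fun _ : V => ℝ) ⊤ :=
  ⟨b.1, memℓp_infty ⟨1, by
    rintro _ ⟨v, rfl⟩
    simpa [abs_of_nonneg (nonneg b v)] using le_one b v⟩⟩

theorem toBdd_apply (b : Realization K) (v : V) : toBdd b v = b.1 v := rfl

theorem continuous_toBdd : Continuous (toBdd (K := K)) := by
  classical
  refine continuous_dom fun s => ?_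
  have : toBdd ∘ incl K s = fun b => ∑ v ∈ s.1, b.1 v • lp.single (E := fun _ : V => ℝ) ⊤ v 1 := by
    funext b
    ext w
    rw [lp.coeFn_sum, Finset.sum_apply]
    simp only [lp.coeFn_smul, Pi.smul_apply, lp.single_apply, smul_eq_mul, Pi.single_apply,
      mul_ite, mul_one, mul_zero, Finset.sum_ite_eq]
    split_ifs with h
    · rfl
    · exact b.2.2.1 w h
  rw [this]
  exact continuous_finsetSum _ fun z _ =>
    ((continuous_apply z).comp continuous_subtype_val).smul continuous_const

/-- An open set of bounded functions on the vertices, of which `|K|` is a retract up to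
homotopy. -/
def nhd (K : AbstractSimplicialComplex V) : Set (lp (fun _ : V => ℝ) ⊤) :=
  {b | (∃ s ∈ K.faces, ∃ ε > 0, ∀ v, v ∉ s → b v ≤ ‖b‖ / 2 - ε) ∧ ∃ v, ‖b‖ / 2 < b v}

/-- Coordinates and norm are 1-Lipschitz, so a move by less than `ε / 4` costs at most `ε / 4 + ε /
8` of the margin `ε`. The bound is uniform in the infinitely many `v` outside `s`: it makes `nhd K`
open and the cut-off coordinates locally finite. -/
theorem apply_le_of_near {b b' : lp (fun _ : V => ℝ) ⊤} {s : Finset V} {ε : ℝ}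
    (h : ∀ v, v ∉ s → b v ≤ ‖b‖ / 2 - ε) (hb : dist b' b < ε / 4) (v : V) (hv : v ∉ s) :
    b' v ≤ ‖b'‖ / 2 - ε / 2 := by
  rw [dist_eq_norm] at hb
  have h1 : ‖(b' - b) v‖ ≤ ‖b' - b‖ := lp.norm_apply_le_norm ENNReal.top_ne_zero _ v
  have h2 : (b' - b) v = b' v - b v := rfl
  have h3 := norm_sub_norm_le b b'
  rw [norm_sub_rev] at h3
  rw [h2, Real.norm_eq_abs] at h1
  have h4 := le_abs_self (b' v - b v)
  have h5 := h v hv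
  have := norm_nonneg (b' - b)
  linarith

theorem continuous_eval (v : V) : Continuous fun b : lp (fun _ : V => ℝ) ⊤ => b v :=
  (lp.evalCLM ℝ (fun _ : V => ℝ) ⊤ v).continuous

theorem isOpen_nhd (K : AbstractSimplicialComplex V) : IsOpen (nhd K) := by
  refine IsOpen.inter ?_ ?_
  · refine Metric.isOpen_iff.2 ?_
    rintro b ⟨s, hs, ε, hε, h⟩
    refine ⟨ε / 4, by positivity, fun b' hb' => ⟨s, hs, ε / 2, by positivity, ?_⟩⟩
    exact apply_le_of_near h hb'
  · have : {b : lp (fun _ : V => ℝ) ⊤ | ∃ v, ‖b‖ / 2 < b v} =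
        ⋃ v, {b : lp (fun _ : V => ℝ) ⊤ | ‖b‖ / 2 < b v} := by
      ext; simp
    change IsOpen {b : lp (fun _ : V => ℝ) ⊤ | ∃ v, ‖b‖ / 2 < b v}
    rw [this]
    exact isOpen_iUnion fun v => isOpen_lt (by fun_prop) (continuous_eval v)

/-- The norm is attained at the largest coordinate, which exceeds half of it; outside a face the
coordinates vanish, which leaves the margin `‖b‖ / 2`. -/
theorem toBdd_mem_nhd (b : Realization K) : toBdd b ∈ nhd K := by
  obtain ⟨s, hs, hb⟩ := b.2
  obtain ⟨w, hws, hw⟩ := exists_pos_of_mem hb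
  obtain ⟨v, hv, hmax⟩ := s.exists_max_image b.1 ⟨w, hws⟩
  have hvpos : 0 < b.1 v := hw.trans_le (hmax w hws)
  have hn : ‖toBdd b‖ ≤ b.1 v := lp.norm_le_of_forall_le hvpos.le fun i => by
    rw [toBdd_apply, Real.norm_eq_abs, abs_of_nonneg (nonneg b i)]
    by_cases hi : i ∈ s
    · exact hmax i hi
    · rw [hb.2.1 i hi]
      exact hvpos.le
  have hn' : 0 < ‖toBdd b‖ := by
    have := lp.norm_apply_le_norm ENNReal.top_ne_zero (toBdd b) v
    rw [toBdd_apply, Real.norm_eq_abs] at this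
    exact (abs_pos.2 hvpos.ne').trans_le this
  refine ⟨⟨s, hs, ‖toBdd b‖ / 2, by positivity, fun i hi => ?_⟩, v, ?_⟩
  · rw [toBdd_apply, hb.2.1 i hi]
    linarith
  · rw [toBdd_apply]
    linarith

/-- The coordinates, cut off at half of the norm. -/
noncomputable def bump (b : lp (fun _ : V => ℝ) ⊤) (v : V) : ℝ := max 0 (b v - ‖b‖ / 2)

theorem continuous_bump (v : V) : Continuous fun b : lp (fun _ : V => ℝ) ⊤ => bump b v :=
  continuous_const.max ((continuous_eval v).sub (by fun_prop))

theorem bump_toBdd_eq_zero {b : Realization K} {v : V} (h : b.1 v = 0) : bump (toBdd b) v = 0 :=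
  max_eq_left (by
    rw [toBdd_apply, h]
    linarith [norm_nonneg (toBdd b)])

theorem exists_bump_pos {b : lp (fun _ : V => ℝ) ⊤} (hb : b ∈ nhd K) : ∃ v, 0 < bump b v := by
  obtain ⟨v, hv⟩ := hb.2
  exact ⟨v, lt_max_of_lt_right (sub_pos.2 hv)⟩

/-- Maps into the neighbourhood of `|K|` yield maps into the subcomplex induced on a set of
vertices containing all relevant ones. -/
theorem exists_of_nhd (K : AbstractSimplicialComplex V) (α : S ↪ V) {Y : Type*}
    [TopologicalSpace Y] (j : Y → lp (fun _ : V => ℝ) ⊤) (hj : Continuous j)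
    (hjK : ∀ y, j y ∈ nhd K) (hα : ∀ y v, 0 < bump (j y) v → v ∈ Set.range α) :
    ∃ f : C(Y, Realization (comap K α)), ∀ y i,
      (f y).1 i = bump (j y) (α i) / ∑ᶠ i, bump (j y) (α i) := by
  classical
  -- One face controls a whole neighbourhood of `y`. This gives both the support in a face and the
  -- local finiteness that `exists_normalize` asks for; the uncut coordinates need not be locally
  -- finite.
  have hloc : ∀ y, ∃ s ∈ K.faces, ∀ᶠ y' in 𝓝 y, ∀ v, v ∉ s → bump (j y') v = 0 := fun y => by
    obtain ⟨s, hs, ε, hε, h⟩ := (hjK y).1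
    refine ⟨s, hs, ?_⟩
    filter_upwards [hj.continuousAt.eventually (Metric.ball_mem_nhds (j y) (by positivity :
      0 < ε / 4))] with y' hy' v hv
    refine max_eq_left ?_
    linarith [apply_le_of_near h hy' v hv]
  have hpos : ∀ y, ∃ i, 0 < bump (j y) (α i) := fun y => by
    obtain ⟨v, hv⟩ := exists_bump_pos (hjK y)
    obtain ⟨i, rfl⟩ := hα y v hv
    exact ⟨i, hv⟩
  refine exists_normalize (comap K α) (fun y i => bump (j y) (α i)) (fun y i => le_max_left _ _)
    hpos (fun i => (continuous_bump _).comp hj) (fun y => ?_) fun y => ?_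
  · obtain ⟨s, hs, h⟩ := hloc y
    refine ⟨s.preimage α α.injective.injOn, (K.isRelLowerSet_faces hs).2 ?_ ?_, fun i hi => ?_⟩
    · rw [Finset.map_subset_iff_subset_preimage]
    · obtain ⟨i, hi⟩ := hpos y
      refine Finset.map_nonempty.2 ⟨i, Finset.mem_preimage.2 ?_⟩
      by_contra h'
      exact hi.ne' (h.self_of_nhds _ h')
    · exact h.self_of_nhds _ fun h' => hi (Finset.mem_preimage.2 h')
  · obtain ⟨s, -, h⟩ := hloc y
    exact ⟨s.preimage α α.injective.injOn, h.mono fun y' hy' i hi =>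
      hy' _ fun h' => hi (Finset.mem_preimage.2 h')⟩

/-- The deformation of `|K|` which cuts off small coordinates. -/
theorem bump_homotopy {v₀ : V} (r : PMap (pointedPolyhedron K v₀) (pointedPolyhedron K v₀))
    (hr : ∀ (b : Realization K) v, (r.1 b).1 v = bump (toBdd b) v / ∑ᶠ w, bump (toBdd b) w) :
    r.cls = 𝟙 (pointedPolyhedron K v₀) := by
  have hmem : ∀ (s : Finset V) (b : Realization K), b.1 ∈ closedSimplex s →
      (r.1 b).1 ∈ closedSimplex s := fun s b hb => by
    rw [show (r.1 b).1 = _ from funext (hr b)]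
    exact normalize_mem (fun v => le_max_left _ _)
      (fun v hv => bump_toBdd_eq_zero (hb.2.1 v hv)) (exists_bump_pos (toBdd_mem_nhd b))
  -- Cutting off creates no new nonzero coordinates, so `b` and `r b` share a closed simplex and the
  -- segment between them stays in `|K|`.
  let H : Realization K × I → Realization K := fun a =>
    ⟨fun v => (1 - (a.2 : ℝ)) * (r.1 a.1).1 v + a.2 * a.1.1 v, by
      obtain ⟨s, hs, hb⟩ := a.1.2
      exact ⟨s, hs, closedSimplex_convex (hmem s a.1 hb) hb a.2⟩⟩
  refine PMap.cls_eq_of_homotopy (g := ⟨ContinuousMap.id _, rfl⟩) H ?_ ?_ ?_ ?_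
  · refine continuous_dom_prod fun s => ?_
    have hc : ∀ v, Continuous fun b : closedSimplex s.1 => (r.1 (incl K s b)).1 v := fun v =>
      (continuous_coord (K := K) v).comp (r.1.continuous.comp (continuous_incl s))
    refine (continuous_incl s).comp (Continuous.subtype_mk
      (f := fun a : closedSimplex s.1 × I => (H (incl K s a.1, a.2)).1) ?_ fun a =>
        closedSimplex_convex (hmem s.1 (incl K s a.1) a.1.2) a.1.2 a.2)
    refine continuous_pi fun v => ?_
    have h1 := (hc v).comp (continuous_fst (X := closedSimplex s.1) (Y := I))
    have h2 : Continuous fun a : closedSimplex s.1 × I => a.1.1 v :=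
      (continuous_apply v).comp (continuous_subtype_val.comp continuous_fst)
    have h3 : Continuous fun a : closedSimplex s.1 × I => (a.2 : ℝ) := by fun_prop
    exact ((continuous_const.sub h3).mul h1).add (h3.mul h2)
  · exact fun b => ext fun v => by simp [H]
  · exact fun b => ext fun v => by simp [H]
  · intro t
    -- The closed simplex of a single vertex is a point, so the base point does not move.
    refine eq_vertex ?_
    exact closedSimplex_convex (hmem _ _ (vertex_mem v₀)) (vertex_mem v₀) t

theorem finsum_bump_comp (b : lp (fun _ : V => ℝ) ⊤) (α : S ↪ V)
    (hα : ∀ v, 0 < bump b v → v ∈ Set.range α) :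
    ∑ᶠ i, bump b (α i) = ∑ᶠ v, bump b v := by
  rw [← finsum_mem_range α.injective, finsum_mem_def]
  refine finsum_congr fun v => ?_
  by_cases h : v ∈ Set.range α
  · rw [Set.indicator_of_mem h]
  · rw [Set.indicator_of_notMem h]
    exact le_antisymm (le_max_left _ _) (not_lt.1 fun h' => h (hα v h'))

/-- A map into a polyhedron factors, up to homotopy, through the subcomplex induced on a set of
vertices which contains the carriers of all points of the image. -/
theorem exists_factor {X : PSpace.{u}} {v₀ : V} (f : PMap X (pointedPolyhedron K v₀)) (α : S ↪ V)
    (hα : ∀ x v, (f.1 x).1 v ≠ 0 → v ∈ Set.range α) :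
    ∃ (i₀ : S) (g : X ⟶ pointedPolyhedron (comap K α) i₀)
      (h : pointedPolyhedron (comap K α) i₀ ⟶ pointedPolyhedron K v₀), g ≫ h = f.cls := by
  have hpos : ∀ (b : Realization K) v, 0 < bump (toBdd b) v → b.1 v ≠ 0 := fun b v h h' =>
    h.ne' (bump_toBdd_eq_zero h')
  obtain ⟨i₀, hi₀⟩ := hα X.pt v₀ (by rw [f.2]; simp [pointedPolyhedron, vertex])
  let j : X.carrier → lp (fun _ : V => ℝ) ⊤ := fun x => toBdd (f.1 x)
  have hj : Continuous j := continuous_toBdd.comp f.1.continuous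
  have hjα : ∀ x v, 0 < bump (j x) v → v ∈ Set.range α := fun x v h => hα x v (hpos _ v h)
  obtain ⟨g, hg⟩ := exists_of_nhd K α j hj (fun x => toBdd_mem_nhd _) hjα
  obtain ⟨r', hr'⟩ := exists_of_nhd K (Function.Embedding.refl V) (fun b : Realization K => toBdd b)
    continuous_toBdd toBdd_mem_nhd fun b v _ => ⟨v, rfl⟩
  have hr'' : ∀ b v, (r' b).1 v = bump (toBdd b) v / ∑ᶠ w, bump (toBdd b) w := hr'
  let r := (extendMap K (Function.Embedding.refl V)).comp r'
  have hr : ∀ b v, (r b).1 v = bump (toBdd b) v / ∑ᶠ w, bump (toBdd b) w := fun b v =>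
    ((Function.Embedding.refl V).injective.extend_apply _ _ v).trans (hr'' b v)
  have hrpt : r (vertex K v₀) = vertex K v₀ := by
    refine eq_vertex ?_
    rw [show (r (vertex K v₀)).1 = _ from funext (hr _)]
    exact normalize_mem (fun v => le_max_left _ _)
      (fun v hv => bump_toBdd_eq_zero ((vertex_mem v₀).2.1 v hv))
      (exists_bump_pos (toBdd_mem_nhd _))
  have hrf : ∀ x v, (r (f.1 x)).1 v = bump (j x) v / ∑ᶠ w, bump (j x) w := fun x => hr (f.1 x)
  -- Both sides are the normalised cut-off of `f x`, computed over the smaller and over the full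
  -- vertex set. The factorization is therefore strict for `f` followed by `r`, and `r` is homotopic
  -- to the identity.
  have hu : ∀ x, extendMap K α (g x) = r (f.1 x) := fun x => ext fun v => by
    by_cases h : v ∈ Set.range α
    · obtain ⟨i, rfl⟩ := h
      refine (α.injective.extend_apply _ _ i).trans ?_
      refine Eq.trans ?_ (hrf x (α i)).symm
      rw [hg, finsum_bump_comp _ _ (hjα x)]
    · refine (Function.extend_apply' _ _ _ h).trans ?_
      refine Eq.trans ?_ (hrf x v).symm
      rw [show bump (j x) v = 0 from bump_toBdd_eq_zero (by
        by_contra h'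
        exact h (hα x v h')), zero_div]
      rfl
  have hinj : ∀ a b, extendMap K α a = extendMap K α b → a = b := fun a b hab => ext fun i => by
    have := congrFun (congrArg Subtype.val hab) (α i)
    refine (α.injective.extend_apply a.1 0 i).symm.trans (this.trans ?_)
    exact α.injective.extend_apply b.1 0 i
  have hgpt : g X.pt = vertex (comap K α) i₀ := hinj _ _ (by
    rw [hu, extendMap_vertex, hi₀, f.2]
    exact hrpt)
  let G : PMap X (pointedPolyhedron (comap K α) i₀) := ⟨g, hgpt⟩
  let u : PMap (pointedPolyhedron (comap K α) i₀) (pointedPolyhedron K v₀) :=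
    ⟨extendMap K α, by
      subst hi₀
      exact extendMap_vertex K α i₀⟩
  let ρ : PMap (pointedPolyhedron K v₀) (pointedPolyhedron K v₀) := ⟨r, hrpt⟩
  refine ⟨i₀, G.cls, u.cls, ?_⟩
  have : G.comp u = f.comp ρ := Subtype.ext (ContinuousMap.ext hu)
  rw [PMap.comp_cls, this, ← PMap.comp_cls, bump_homotopy ρ hr, Category.comp_id]

end Realization

open Realization

/-- Pointed polyhedra are homotopy retracts of pointed open subsets of normed spaces. -/
theorem exists_isOpenInNormed {V : Type u} (K : AbstractSimplicialComplex V) (v₀ : V) :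
    ∃ (Z : PSpace.{u}) (_ : IsOpenInNormed Z) (j : pointedPolyhedron K v₀ ⟶ Z)
      (r : Z ⟶ pointedPolyhedron K v₀), j ≫ r = 𝟙 _ := by
  let Z : PSpace.{u} := ⟨nhd K, ⟨toBdd (vertex K v₀), toBdd_mem_nhd _⟩⟩
  obtain ⟨r', hr'⟩ := exists_of_nhd K (Function.Embedding.refl V) (fun b : nhd K => b.1)
    continuous_subtype_val (fun b => b.2) fun b v _ => ⟨v, rfl⟩
  let r := (extendMap K (Function.Embedding.refl V)).comp r'
  have hr : ∀ b v, (r b).1 v = bump b.1 v / ∑ᶠ w, bump b.1 w := fun b v =>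
    ((Function.Embedding.refl V).injective.extend_apply _ _ v).trans (hr' b v)
  have hrpt : r Z.pt = vertex K v₀ := by
    refine eq_vertex ?_
    rw [show (r Z.pt).1 = _ from funext (hr _)]
    exact normalize_mem (fun v => le_max_left _ _)
      (fun v hv => bump_toBdd_eq_zero ((vertex_mem v₀).2.1 v hv))
      (exists_bump_pos (toBdd_mem_nhd _))
  let j : PMap (pointedPolyhedron K v₀) Z :=
    ⟨⟨fun b => ⟨toBdd b, toBdd_mem_nhd _⟩, continuous_toBdd.subtype_mk _⟩, rfl⟩
  let ρ : PMap Z (pointedPolyhedron K v₀) := ⟨r, hrpt⟩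
  exact ⟨Z, ⟨lp (fun _ : V => ℝ) ⊤, inferInstance, inferInstance, Subtype.val,
    (isOpen_nhd K).isOpenEmbedding_subtypeVal⟩, j.cls, ρ.cls, bump_homotopy (j.comp ρ)
    fun b v => hr _ v⟩

/-! ### A set of polyhedra that suffices for all maps from a given space -/

/-- The pointed maps up to homotopy from `X` to pointed polyhedra of bounded size. -/
structure SmallPolyhedron (X : PSpace.{u}) : Type u where
  /-- the vertices -/
  vertices : Set (X.carrier × ℕ)
  /-- the complex -/
  complex : AbstractSimplicialComplex vertices
  /-- the base point -/
  base : vertices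
  /-- the map -/
  map : X ⟶ pointedPolyhedron complex base

namespace SmallPolyhedron

variable {X : PSpace.{u}}

/-- The pointed polyhedron. -/
noncomputable abbrev space (a : SmallPolyhedron X) : PSpace.{u} := pointedPolyhedron a.complex a.base

/-- A morphism `a ⟶ b` is a map of the polyhedron of `b` to that of `a`, under `X`. -/
noncomputable instance : Category (SmallPolyhedron X) where
  Hom a b := {h : b.space ⟶ a.space // b.map ≫ h = a.map}
  id a := ⟨𝟙 _, Category.comp_id _⟩
  comp f g := ⟨g.1 ≫ f.1, by rw [← Category.assoc, g.2, f.2]⟩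
  id_comp f := Subtype.ext (Category.comp_id _)
  comp_id f := Subtype.ext (Category.id_comp _)
  assoc f g h := Subtype.ext (Category.assoc _ _ _).symm

/-- Each point of `X` has a finite carrier, so listing the carriers enumerates all relevant vertices
by pairs in `X × ℕ`. A subset of `X × ℕ` on which the enumeration is bijective indexes the induced
subcomplex. -/
theorem exists_factor_polyhedron {V : Type u} {K : AbstractSimplicialComplex V} {v : V}
    (f : X ⟶ pointedPolyhedron K v) :
    ∃ (a : SmallPolyhedron X) (h : a.space ⟶ pointedPolyhedron K v), a.map ≫ h = f := by
  obtain ⟨f, rfl⟩ := PMap.exists_cls f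
  choose s _ _ hs using fun x => Realization.exists_carrier (f.1 x)
  -- Beyond the end of a list the default is `v`; an additional vertex does no harm.
  let g : X.carrier × ℕ → V := fun p => (s p.1).toList.getD p.2 v
  obtain ⟨S, -, hS⟩ := Set.exists_subset_bijOn Set.univ g
  let α : S ↪ V := ⟨fun p => g p.1, fun p q h => Subtype.ext (hS.injOn p.2 q.2 h)⟩
  obtain ⟨i₀, m, h, hmh⟩ := Realization.exists_factor f α fun x w hw => by
    obtain ⟨n, hn, hnw⟩ := List.mem_iff_getElem.1 (Finset.mem_toList.2 ((hs x w).2 hw))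
    obtain ⟨p, hp, hpw⟩ := hS.surjOn ⟨(x, n), trivial, rfl⟩
    refine ⟨⟨p, hp⟩, hpw.trans ?_⟩
    simp only [g]
    rw [List.getD_eq_getElem _ _ hn, hnw]
  exact ⟨⟨S, _, i₀, m⟩, h, hmh⟩

theorem exists_factor_hPol {Q : PSpace.{u}} (hQ : HPol Q) (f : X ⟶ Q) :
    ∃ (a : SmallPolyhedron X) (h : a.space ⟶ Q), a.map ≫ h = f := by
  obtain ⟨V, K, v, ⟨e⟩⟩ := hQ
  obtain ⟨a, h, ha⟩ := exists_factor_polyhedron (f ≫ e.hom)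
  exact ⟨a, h ≫ e.inv, by rw [← Category.assoc, ha, Category.assoc, e.hom_inv_id,
    Category.comp_id]⟩

theorem exists_factor_open {Z : PSpace.{u}} (hZ : IsOpenInNormed Z) (f : X ⟶ Z) :
    ∃ (a : SmallPolyhedron X) (h : a.space ⟶ Z), a.map ≫ h = f := by
  obtain ⟨V, K, v, s, r, hsr⟩ := hZ.exists_retract
  obtain ⟨a, h, ha⟩ := exists_factor_polyhedron (f ≫ s)
  exact ⟨a, h ≫ r, by rw [← Category.assoc, ha, Category.assoc, hsr, Category.comp_id]⟩

end SmallPolyhedron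

/-! ### Products and homotopy equalizers of open subsets of normed spaces -/

/-- Maps to two pointed open subsets of normed spaces factor through a common one. -/
theorem IsOpenInNormed.exists_prod {X Z Z' : PSpace.{u}} (hZ : IsOpenInNormed Z)
    (hZ' : IsOpenInNormed Z') (f : X ⟶ Z) (f' : X ⟶ Z') :
    ∃ (W : PSpace.{u}) (_ : IsOpenInNormed W) (g : X ⟶ W) (p : W ⟶ Z) (p' : W ⟶ Z'),
      g ≫ p = f ∧ g ≫ p' = f' := by
  obtain ⟨E, _, _, e, he⟩ := hZ
  obtain ⟨E', _, _, e', he'⟩ := hZ'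
  obtain ⟨f, rfl⟩ := PMap.exists_cls f
  obtain ⟨f', rfl⟩ := PMap.exists_cls f'
  let W : PSpace.{u} := ⟨Z.carrier × Z'.carrier, (Z.pt, Z'.pt)⟩
  let g : PMap X W := ⟨f.1.prodMk f'.1, Prod.ext f.2 f'.2⟩
  let p : PMap W Z := ⟨ContinuousMap.fst, rfl⟩
  let p' : PMap W Z' := ⟨ContinuousMap.snd, rfl⟩
  exact ⟨W, ⟨E × E', inferInstance, inferInstance, Prod.map e e', he.prodMap he'⟩, g.cls, p.cls,
    p'.cls, rfl, rfl⟩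

/-- The homotopy equalizer of two maps between open subsets of normed spaces, thickened so as to
be such an open subset. -/
theorem IsOpenInNormed.exists_equalizer {X Z Y : PSpace.{u}} (hZ : IsOpenInNormed Z)
    (hY : IsOpenInNormed Y) (f : X ⟶ Z) (u₀ u₁ : Z ⟶ Y) (h : f ≫ u₀ = f ≫ u₁) :
    ∃ (W : PSpace.{u}) (_ : IsOpenInNormed W) (g : X ⟶ W) (p : W ⟶ Z),
      g ≫ p = f ∧ p ≫ u₀ = p ≫ u₁ := by
  obtain ⟨E, _, _, e, he⟩ := hZ
  obtain ⟨F, _, _, i, hi⟩ := hY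
  obtain ⟨f, rfl⟩ := PMap.exists_cls f
  obtain ⟨u₀, rfl⟩ := PMap.exists_cls u₀
  obtain ⟨u₁, rfl⟩ := PMap.exists_cls u₁
  obtain ⟨H, hH, hH0, hH1, hHpt⟩ := PMap.exists_homotopy_of_cls_eq (f := f.comp u₀)
    (g := f.comp u₁) h
  have hic := hi.continuous
  -- An affine correction makes an arbitrary path in `F` run from `u₀ z` to `u₁ z`. Imposing these
  -- endpoints on the path itself would be a closed condition; with the correction, only the open
  -- condition `S` remains.
  let G : (Z.carrier × C(I, F)) × I → F := fun a => a.1.2 a.2 +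
    ((1 - (a.2 : ℝ)) • (i (u₀.1 a.1.1) - a.1.2 0) + (a.2 : ℝ) • (i (u₁.1 a.1.1) - a.1.2 1))
  have hG : Continuous G := by fun_prop
  let G' : Z.carrier × C(I, F) → C(I, F) := fun a => ⟨fun t => G (a, t), by fun_prop⟩
  have hG' : Continuous G' := ContinuousMap.continuous_of_continuous_uncurry _ hG
  let S : Set (Z.carrier × C(I, F)) := {a | Set.MapsTo (G' a) Set.univ (Set.range i)}
  have hS : IsOpen S :=
    (ContinuousMap.isOpen_setOfPred_mapsTo isCompact_univ hi.isOpen_range).preimage hG'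
  let path : X.carrier → C(I, F) := fun x => ⟨fun t => i (H (x, t)), by fun_prop⟩
  have hpath : Continuous path :=
    ContinuousMap.continuous_of_continuous_uncurry _ (by
      change Continuous fun a : X.carrier × I => i (H (a.1, a.2))
      fun_prop)
  have hGpath : ∀ x t, G ((f.1 x, path x), t) = i (H (x, t)) := fun x t => by
    have h0 : path x 0 = i (u₀.1 (f.1 x)) := congrArg i (hH0 x)
    have h1 : path x 1 = i (u₁.1 (f.1 x)) := congrArg i (hH1 x)
    simp only [G, h0, h1, sub_self, smul_zero, add_zero]
    rfl
  have hmem : ∀ x, (f.1 x, path x) ∈ S := fun x t _ => ⟨_, (hGpath x t).symm⟩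
  let W : PSpace.{u} := ⟨S, ⟨(f.1 X.pt, path X.pt), hmem _⟩⟩
  let g : PMap X W := ⟨⟨fun x => ⟨(f.1 x, path x), hmem x⟩, by fun_prop⟩, rfl⟩
  let p : PMap W Z := ⟨⟨fun a => a.1.1, by fun_prop⟩, f.2⟩
  have hW : IsOpenInNormed W := ⟨E × C(I, F), inferInstance, inferInstance,
    Prod.map e id ∘ Subtype.val, (he.prodMap .id).comp hS.isOpenEmbedding_subtypeVal⟩
  -- The corrected paths lie in the image of `i`; lifted to `Y`, they are the homotopy between the
  -- two composites.
  have hL : ∀ a : S × I, ∃ y, i y = G (a.1.1, a.2) := fun a => a.1.2 (Set.mem_univ a.2)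
  choose L hL using hL
  refine ⟨W, hW, g.cls, p.cls, rfl, ?_⟩
  refine PMap.cls_eq_of_homotopy (f := p.comp u₀) (g := p.comp u₁) L ?_ ?_ ?_ ?_
  · rw [hi.isInducing.continuous_iff, show i ∘ L = _ from funext hL]
    fun_prop
  · intro a
    refine hi.injective ((hL _).trans ?_)
    simp only [G, Set.Icc.coe_zero, sub_zero, one_smul, zero_smul, add_zero, add_sub_cancel]
    rfl
  · intro a
    refine hi.injective ((hL _).trans ?_)
    simp only [G, Set.Icc.coe_one, sub_self, one_smul, zero_smul, zero_add, add_sub_cancel]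
    rfl
  · intro t
    refine hi.injective ((hL _).trans ((hGpath _ _).trans ?_))
    rw [hHpt]

/-! ### Filteredness and the existence of expansions -/

namespace SmallPolyhedron

variable {X : PSpace.{u}}

/-- Two maps to a polyhedron which agree on `X` agree on a later small polyhedron. -/
theorem exists_hom_equalizing (a : SmallPolyhedron X) {Q : PSpace.{u}} (hQ : HPol Q)
    (f₀ f₁ : a.space ⟶ Q) (h : a.map ≫ f₀ = a.map ≫ f₁) :
    ∃ (c : SmallPolyhedron X) (m : a ⟶ c), m.1 ≫ f₀ = m.1 ≫ f₁ := by
  obtain ⟨V, K, v, ⟨e⟩⟩ := hQ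
  obtain ⟨Z, hZ, j, r, hjr⟩ := exists_isOpenInNormed a.complex a.base
  obtain ⟨Y, hY, i, q, hiq⟩ := exists_isOpenInNormed K v
  have hj (T : PSpace.{u}) (k : a.space ⟶ T) : (a.map ≫ j) ≫ r ≫ k = a.map ≫ k := by
    rw [Category.assoc, ← Category.assoc j, hjr, Category.id_comp]
  -- Both maps are transported to the open sets `Z` and `Y`, equalized there, and brought back by
  -- the retractions.
  obtain ⟨W, hW, g, p, hgp, hp⟩ := hZ.exists_equalizer hY (a.map ≫ j)
    (r ≫ f₀ ≫ e.hom ≫ i) (r ≫ f₁ ≫ e.hom ≫ i) (by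
      rw [hj, hj]
      simpa only [Category.assoc] using congrArg (· ≫ e.hom ≫ i) h)
  obtain ⟨c, k, hc⟩ := exists_factor_open hW g
  refine ⟨c, ⟨k ≫ p ≫ r, ?_⟩, ?_⟩
  · rw [← Category.assoc, hc, ← Category.assoc, hgp, Category.assoc, hjr, Category.comp_id]
  · have := congrArg (fun t => k ≫ t ≫ q ≫ e.inv) hp
    have hiq' (T : PSpace.{u}) (t : pointedPolyhedron K v ⟶ T) : i ≫ q ≫ t = t := by
      rw [← Category.assoc, hiq, Category.id_comp]
    simp only [Category.assoc, hiq', e.hom_inv_id, Category.comp_id] at this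
    simpa only [Category.assoc] using this

/-- Polyhedra are replaced by the open sets of which they are retracts. There a point, a product and
a homotopy equalizer give the three axioms, and `exists_factor_open` returns to a small polyhedron.
-/
instance : IsFiltered (SmallPolyhedron X) where
  nonempty := by
    let Z : PSpace.{u} := ⟨PUnit.{u + 1}, PUnit.unit⟩
    let c : PMap X Z := ⟨ContinuousMap.const _ PUnit.unit, rfl⟩
    have hZ : IsOpenInNormed Z := ⟨PUnit.{u + 1}, inferInstance, inferInstance, id, .id⟩
    exact ⟨(exists_factor_open hZ c.cls).choose⟩
  cocone_objs a b := by
    obtain ⟨Z, hZ, j, r, hjr⟩ := exists_isOpenInNormed a.complex a.base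
    obtain ⟨Z', hZ', j', r', hjr'⟩ := exists_isOpenInNormed b.complex b.base
    obtain ⟨W, hW, g, p, p', hp, hp'⟩ := hZ.exists_prod hZ' (a.map ≫ j) (b.map ≫ j')
    obtain ⟨c, h, hc⟩ := exists_factor_open hW g
    refine ⟨c, ⟨h ≫ p ≫ r, ?_⟩, ⟨h ≫ p' ≫ r', ?_⟩, trivial⟩
    · rw [← Category.assoc, hc, ← Category.assoc, hp, Category.assoc, hjr, Category.comp_id]
    · rw [← Category.assoc, hc, ← Category.assoc, hp', Category.assoc, hjr', Category.comp_id]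
  cocone_maps a b f f' := by
    obtain ⟨c, m, hm⟩ := exists_hom_equalizing b ⟨_, _, _, ⟨Iso.refl a.space⟩⟩ f.1 f'.1
      (f.2.trans f'.2.symm)
    exact ⟨c, m, Subtype.ext hm⟩

end SmallPolyhedron

/-- Every pointed space has an `HPol_*`-expansion. -/
theorem exists_expansion (X : PSpace.{u}) : Nonempty (Expansion.{u} HPol X) := by
  -- The index of an inverse system must be a directed preorder, so the filtered category is
  -- replaced by a directed set with a final functor to it.
  obtain ⟨A, _, hdir, hne, F, hF⟩ := IsFiltered.exists_directed (SmallPolyhedron X)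
  have : IsFiltered A := inferInstance
  refine ⟨{
    sys := {
      Idx := A
      obj := fun a => (F.obj a).space
      bond := fun h => (F.map (homOfLE h)).1
      bond_self := fun a h => ?_
      bond_comp := fun {a b c} h h' => ?_ }
    mem := fun a => ⟨_, _, _, ⟨Iso.refl _⟩⟩
    proj := fun a => (F.obj a).map
    proj_bond := fun h => (F.map (homOfLE h)).2
    factor := fun Q hQ h => ?_
    separate := fun Q hQ a f₀ f₁ h => ?_ }⟩
  · exact congrArg Subtype.val (F.map_id a)
  · exact congrArg Subtype.val (F.map_comp (homOfLE h) (homOfLE h')).symm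
  · obtain ⟨b, k, rfl⟩ := SmallPolyhedron.exists_factor_hPol hQ h
    obtain ⟨a, ⟨m⟩⟩ := ((Functor.final_iff_of_isFiltered F).1 hF).1 b
    exact ⟨a, m.1 ≫ k, by rw [← Category.assoc, m.2]⟩
  · obtain ⟨c, m, hm⟩ := (F.obj a).exists_hom_equalizing hQ f₀ f₁ h
    obtain ⟨b, ⟨n⟩⟩ := ((Functor.final_iff_of_isFiltered F).1 hF).1 c
    obtain ⟨b', hab, hbb⟩ := exists_ge_ge a b
    -- The route through the equalizing object `c` need not agree with the bonding morphism, but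
    -- finality makes them agree at a later index `d`.
    obtain ⟨d, t, ht⟩ := ((Functor.final_iff_of_isFiltered F).1 hF).2
      (F.map (homOfLE hab)) (m ≫ n ≫ F.map (homOfLE hbb))
    refine ⟨d, hab.trans t.le, ?_⟩
    have hval : (F.map (homOfLE (hab.trans t.le))).1 =
        ((F.map t).1 ≫ (F.map (homOfLE hbb)).1 ≫ n.1) ≫ m.1 := by
      rw [show homOfLE (hab.trans t.le) = homOfLE hab ≫ t from rfl, F.map_comp, ht]
      change (F.map t).1 ≫ (((F.map (homOfLE hbb)).1 ≫ n.1) ≫ m.1) = _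
      simp only [Category.assoc]
    change (F.map (homOfLE (hab.trans t.le))).1 ≫ f₀ = (F.map (homOfLE (hab.trans t.le))).1 ≫ f₁
    rw [hval]
    simp only [Category.assoc, hm]

/-- A pointed homeomorphism is an isomorphism of `HTop_*`. -/
def PMap.iso {X Y : PSpace.{u}} (f : PMap X Y) (g : PMap Y X) (hfg : ∀ x, g.1 (f.1 x) = x)
    (hgf : ∀ y, f.1 (g.1 y) = y) : X ≅ Y where
  hom := f.cls
  inv := g.cls
  hom_inv_id := congrArg PMap.cls (Subtype.ext (ContinuousMap.ext hfg) :
    f.comp g = ⟨ContinuousMap.id _, rfl⟩)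
  inv_hom_id := congrArg PMap.cls (Subtype.ext (ContinuousMap.ext hgf) :
    g.comp f = ⟨ContinuousMap.id _, rfl⟩)

/-! ### The sphere as the boundary of a simplex -/

namespace SimplexBoundary

variable (k : ℕ)

/-- The boundary of the `(k+1)`-simplex. -/
def complex : AbstractSimplicialComplex (ULift.{u} (Fin (k + 2))) where
  faces := {s | s.Nonempty ∧ ∃ v, v ∉ s}
  isRelLowerSet_faces := fun _ ⟨hs, v, hv⟩ =>
    ⟨hs, fun _ ht hne => ⟨hne, v, fun h => hv (ht h)⟩⟩
  singleton_mem v := by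
    obtain ⟨w, hw⟩ := exists_ne v
    exact ⟨Finset.singleton_nonempty v, w, by simpa using hw⟩

variable {k}

/-- The values of the coordinates of a vector and of an additional coordinate `0`. -/
def coords (x : EuclideanSpace ℝ (Fin (k + 1))) : Fin (k + 2) → ℝ := Fin.cons 0 x

/-- The smallest coordinate. -/
noncomputable def low (x : EuclideanSpace ℝ (Fin (k + 1))) : ℝ :=
  Finset.univ.inf' Finset.univ_nonempty (coords x)

theorem continuous_coords (i : Fin (k + 2)) :
    Continuous fun x : EuclideanSpace ℝ (Fin (k + 1)) => coords x i := by
  refine Fin.cases ?_ (fun i => ?_) i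
  · exact continuous_const
  · change Continuous fun x : EuclideanSpace ℝ (Fin (k + 1)) => x i
    fun_prop

theorem continuous_low : Continuous (low (k := k)) :=
  Continuous.finset_inf'_apply _ fun i _ => continuous_coords i

theorem low_le (x : EuclideanSpace ℝ (Fin (k + 1))) (i) : low x ≤ coords x i :=
  Finset.inf'_le _ (Finset.mem_univ i)

theorem exists_low (x : EuclideanSpace ℝ (Fin (k + 1))) : ∃ i, coords x i = low x := by
  obtain ⟨i, -, hi⟩ := Finset.exists_mem_eq_inf' Finset.univ_nonempty (coords x)
  exact ⟨i, hi.symm⟩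

theorem exists_low_lt {x : EuclideanSpace ℝ (Fin (k + 1))} (hx : x ≠ 0) :
    ∃ i, low x < coords x i := by
  by_contra! h
  refine hx ?_
  ext i
  have h0 := le_antisymm (h 0) (low_le x 0)
  have h1 := le_antisymm (h i.succ) (low_le x i.succ)
  exact (h1.trans h0.symm :)

/-- The edge vectors from the vertex `0`, weighted by barycentric coordinates. -/
noncomputable def edge (b : Realization (complex.{u} k)) : EuclideanSpace ℝ (Fin (k + 1)) :=
  WithLp.toLp 2 fun i => b.1 ⟨i.succ⟩ - b.1 ⟨0⟩

theorem continuous_edge : Continuous (edge.{u} (k := k)) :=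
  (PiLp.continuous_toLp 2 _).comp (continuous_pi fun _ =>
    (Realization.continuous_coord (K := complex k) _).sub
      (Realization.continuous_coord (K := complex k) _))

theorem exists_eq_zero (b : Realization (complex.{u} k)) : ∃ i, b.1 ⟨i⟩ = 0 := by
  obtain ⟨s, ⟨_, v, hv⟩, hb⟩ := b.2
  exact ⟨v.down, hb.2.1 v hv⟩

theorem sum_eq_one (b : Realization (complex.{u} k)) : ∑ v, b.1 v = 1 := by
  obtain ⟨s, _, hb⟩ := b.2
  exact (Realization.mem_closedSimplex_of_subset hb (Finset.subset_univ s)).2.2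

theorem edge_ne_zero (b : Realization (complex.{u} k)) : edge b ≠ 0 := by
  intro h
  have h0 : ∀ i, b.1 ⟨i⟩ = b.1 ⟨0⟩ := by
    refine Fin.cases rfl fun i => ?_
    have : edge b i = 0 := by rw [h]; rfl
    exact sub_eq_zero.1 this
  obtain ⟨i, hi⟩ := exists_eq_zero b
  have h1 := sum_eq_one b
  rw [Finset.sum_eq_zero fun v _ => (h0 v.down).trans ((h0 i).symm.trans hi)] at h1
  exact zero_ne_one h1

theorem coords_smul_edge (c : ℝ) (b : Realization (complex.{u} k))
    (i : Fin (k + 2)) :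
    coords (c • edge b) i = c * b.1 ⟨i⟩ - c * b.1 ⟨0⟩ := by
  refine Fin.cases ?_ (fun _ => ?_) i
  · rw [sub_self]; rfl
  · rw [← mul_sub]; rfl

/-- On the boundary some barycentric coordinate is zero, and there the least value is attained.
Hence the coordinate at vertex `0`, which `edge` subtracts, can be recovered up to scale. -/
theorem low_smul_edge {c : ℝ} (hc : 0 ≤ c) (b : Realization (complex.{u} k)) :
    low (c • edge b) = -(c * b.1 ⟨0⟩) := by
  obtain ⟨i, hi⟩ := exists_eq_zero b
  refine le_antisymm ((low_le _ i).trans ?_) ?_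
  · rw [coords_smul_edge, hi]; simp
  · obtain ⟨j, hj⟩ := exists_low (c • edge b)
    rw [← hj, coords_smul_edge]
    linarith [mul_nonneg hc (Realization.nonneg b ⟨j⟩)]

theorem normalize_edge_mem (b : Realization (complex.{u} k)) :
    ‖edge b‖⁻¹ • edge b ∈ Metric.sphere (0 : EuclideanSpace ℝ (Fin (k + 1))) 1 := by
  rw [mem_sphere_zero_iff_norm, norm_smul, norm_inv, norm_norm,
    inv_mul_cancel₀ (norm_ne_zero_iff.2 (edge_ne_zero b))]

/-- The projection of the boundary of a simplex to the unit sphere. -/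
noncomputable def toSphere : C(Realization (complex.{u} k),
    Metric.sphere (0 : EuclideanSpace ℝ (Fin (k + 1))) 1) where
  toFun b := ⟨‖edge b‖⁻¹ • edge b, normalize_edge_mem b⟩
  continuous_toFun := Continuous.subtype_mk
    ((continuous_edge.norm.inv₀ fun b => norm_ne_zero_iff.2 (edge_ne_zero b)).smul
      continuous_edge) normalize_edge_mem

/-- The inverse of the radial projection prepends the coordinate `0`, subtracts the least coordinate
and divides by the sum. The subtraction restores a point with a vanishing coordinate and is
invisible to `edge`, which only sees differences; the two normalisations remove the positive
scalars. -/
theorem exists_inverse : ∃ g : C(Metric.sphere (0 : EuclideanSpace ℝ (Fin (k + 1))) 1,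
    Realization (complex.{u} k)), (∀ b, g (toSphere b) = b) ∧ ∀ x, toSphere (g x) = x := by
  obtain ⟨g, hg⟩ := Realization.exists_normalize (complex.{u} k)
    (Y := Metric.sphere (0 : EuclideanSpace ℝ (Fin (k + 1))) 1)
    (fun x v => coords x.1 v.down - low x.1)
    (fun x v => sub_nonneg.2 (low_le _ _))
    (fun x => by
      obtain ⟨i, hi⟩ := exists_low_lt (ne_zero_of_mem_unit_sphere x)
      exact ⟨⟨i⟩, sub_pos.2 hi⟩)
    (fun v => ((continuous_coords v.down).sub continuous_low).comp continuous_subtype_val)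
    (fun x => by
      obtain ⟨i, hi⟩ := exists_low x.1
      obtain ⟨j, hj⟩ := exists_low_lt (ne_zero_of_mem_unit_sphere x)
      refine ⟨Finset.univ.erase ⟨i⟩, ⟨⟨⟨j⟩, ?_⟩, ⟨i⟩, Finset.notMem_erase _ _⟩, fun v hv => ?_⟩
      · refine Finset.mem_erase.2 ⟨fun h => ?_, Finset.mem_univ _⟩
        exact hj.ne' ((congrArg (coords x.1) (congrArg ULift.down h)).trans hi)
      · have : v = ⟨i⟩ := by simpa using hv
        rw [this, sub_eq_zero]
        exact hi)
    (fun _ => ⟨Finset.univ, .of_forall fun _ v hv => absurd (Finset.mem_univ v) hv⟩)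
  refine ⟨g, fun b => Realization.ext fun v => ?_, fun x => Subtype.ext ?_⟩
  · have hpos : 0 < ‖edge b‖ := norm_pos_iff.2 (edge_ne_zero b)
    have key : ∀ v : ULift.{u} (Fin (k + 2)),
        coords (toSphere b).1 v.down - low (toSphere b).1 = ‖edge b‖⁻¹ * b.1 v := fun v => by
      change coords (‖edge b‖⁻¹ • edge b) v.down - low (‖edge b‖⁻¹ • edge b) = _
      rw [coords_smul_edge, low_smul_edge (by positivity)]
      ring
    rw [hg]
    simp only [key]
    rw [finsum_eq_sum_of_fintype, ← Finset.mul_sum, sum_eq_one]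
    field_simp
  · have hx : ‖x.1‖ = 1 := mem_sphere_zero_iff_norm.1 x.2
    set S : ℝ := ∑ᶠ w : ULift.{u} (Fin (k + 2)), (coords x.1 w.down - low x.1) with hS
    have key : edge (g x) = S⁻¹ • x.1 := by
      ext i
      change (g x).1 ⟨i.succ⟩ - (g x).1 ⟨0⟩ = S⁻¹ * x.1 i
      rw [hg, hg]
      change (x.1 i - low x.1) / S - (0 - low x.1) / S = _
      ring
    have hS0 : 0 ≤ S := finsum_nonneg fun w => sub_nonneg.2 (low_le _ _)
    have hne : S⁻¹ ≠ 0 := fun h => edge_ne_zero (g x) (by rw [key, h, zero_smul])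
    have hnorm : ‖edge (g x)‖ = S⁻¹ := by
      rw [key, norm_smul, hx, mul_one, Real.norm_of_nonneg (inv_nonneg.2 hS0)]
    change ‖edge (g x)‖⁻¹ • edge (g x) = x.1
    rw [hnorm, key, smul_smul, inv_mul_cancel₀ hne, one_smul]

theorem edge_vertex :
    edge (Realization.vertex (complex.{u} k) ⟨(0 : Fin (k + 1)).succ⟩) =
      EuclideanSpace.single 0 1 := by
  have h0 := (Realization.vertex_mem (K := complex.{u} k) ⟨(0 : Fin (k + 1)).succ⟩).2.1
  have h1 := (Realization.vertex_mem (K := complex.{u} k) ⟨(0 : Fin (k + 1)).succ⟩).2.2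
  rw [Finset.sum_singleton] at h1
  ext i
  change (Realization.vertex (complex.{u} k) _).1 ⟨i.succ⟩ -
    (Realization.vertex (complex.{u} k) _).1 ⟨0⟩ = _
  rw [h0 ⟨0⟩ (by simp [ULift.ext_iff]), sub_zero]
  by_cases hi : i = 0
  · subst hi
    simpa using h1
  · rw [h0 ⟨i.succ⟩ fun h =>
      hi (Fin.succ_injective _ (congrArg ULift.down (Finset.mem_singleton.1 h)))]
    simp [hi]

end SimplexBoundary

open SimplexBoundary in
/-- The sphere is homeomorphic to the boundary of a simplex. -/
theorem hPol_sphere (k : ℕ) : HPol (sphere.{u} k) := by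
  obtain ⟨g, hgf, hfg⟩ := exists_inverse.{u} (k := k)
  have hpt : toSphere (Realization.vertex (complex.{u} k) ⟨(0 : Fin (k + 1)).succ⟩) =
      (sphere.{u} k).pt.down := Subtype.ext (by
    change ‖edge _‖⁻¹ • edge _ = EuclideanSpace.single 0 1
    rw [edge_vertex]
    simp)
  let f' : PMap (pointedPolyhedron (complex.{u} k) ⟨(0 : Fin (k + 1)).succ⟩) (sphere.{u} k) :=
    ⟨⟨fun b => ⟨toSphere b⟩, continuous_uliftUp.comp toSphere.continuous⟩, congrArg ULift.up hpt⟩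
  let g' : PMap (sphere.{u} k) (pointedPolyhedron (complex.{u} k) ⟨(0 : Fin (k + 1)).succ⟩) :=
    ⟨⟨fun x => g x.down, g.continuous.comp continuous_uliftDown⟩,
      (congrArg g hpt).symm.trans (hgf _)⟩
  exact ⟨_, complex k, _, ⟨g'.iso f' (fun x => congrArg ULift.up (hfg x.down)) hgf⟩⟩

/-! ### Coarse shape morphisms over a fixed expansion, and their topology -/

section Generic

variable {C : Type u} [Category.{v} C]

theorem evAgree_rudimentary_iff {A Z : C} {f g : ℕ → (A ⟶ Z)} :
    EvAgree (rudimentary.{w} A) (a := PUnit.unit) (b := PUnit.unit) f g ↔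
      ∃ N, ∀ n, N ≤ n → f n = g n := by
  have key : ∀ x : A ⟶ Z, 𝟙 A ≫ x = x := Category.id_comp
  constructor
  · rintro ⟨c, ha, hb, N, H⟩
    exact ⟨N, fun n hn => (key _).symm.trans ((H n hn).trans (key _))⟩
  · rintro ⟨N, H⟩
    exact ⟨PUnit.unit, le_rfl, le_rfl, N, fun n hn => (key _).trans ((H n hn).trans (key _).symm)⟩

/-- The `n`-th morphism from `A` to the `l`-th term. -/
def StarMor.term {A : C} {X : InvSystem.{w} C} (f : StarMor (rudimentary A) X) (n : ℕ)
    (l : X.Idx) : A ⟶ X.obj l :=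
  f.mor n l

theorem StarMor.exists_term_bond {A : C} {X : InvSystem.{w} C} (f : StarMor (rudimentary A) X)
    {l l' : X.Idx} (h : l ≤ l') : ∃ N, ∀ n, N ≤ n → f.term n l' ≫ X.bond h = f.term n l :=
  evAgree_rudimentary_iff.1 (f.comm h)

/-- An `S*`-morphism from an object, given by its terms. -/
def StarMor.ofTerm {A : C} {X : InvSystem.{w} C} (t : ℕ → ∀ l, A ⟶ X.obj l)
    (h : ∀ (l l' : X.Idx) (h : l ≤ l'), ∃ N, ∀ n, N ≤ n → t n l' ≫ X.bond h = t n l) :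
    StarMor (rudimentary A) X where
  idx _ := PUnit.unit
  mor := t
  comm hl := evAgree_rudimentary_iff.2 (h _ _ hl)

theorem StarMor.toPro_eq_iff {A : C} {X : InvSystem.{w} C} {f g : StarMor (rudimentary A) X} :
    f.toPro = g.toPro ↔ ∀ l, ∃ N, ∀ n, N ≤ n → f.term n l = g.term n l :=
  ⟨fun h l => evAgree_rudimentary_iff.1 (Quotient.exact h l),
    fun h => Quotient.sound fun l => evAgree_rudimentary_iff.2 (h l)⟩

theorem StarMor.toPro_eq_of_term {A : C} {X : InvSystem.{w} C} {f g : StarMor (rudimentary A) X}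
    (h : ∀ n l, f.term n l = g.term n l) : f.toPro = g.toPro :=
  toPro_eq_iff.2 fun l => ⟨0, fun n _ => h n l⟩

theorem StarMor.exists_toPro {X Y : InvSystem.{w} C} (F : X ⟶ Y) :
    ∃ f : StarMor X Y, f.toPro = F :=
  Quotient.exists_rep F

namespace Sh

variable {P : ObjectProperty C} {A B : C}

theorem mk_eq_mk_iff (q : Expansion.{w} P B) (p p' : Expansion.{w} P A) (f : q.sys ⟶ p.sys)
    (g : q.sys ⟶ p'.sys) : mk q p f = mk q p' g ↔ g = f ≫ Expansion.nat p p' := by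
  have : mk q p f = mk q p' g ↔
      Expansion.nat q q ≫ g = f ≫ Expansion.nat p p' := Quotient.eq (r := repSetoid P B A)
  rw [this, Expansion.nat_self, Category.id_comp]

theorem mk_injective (q : Expansion.{w} P B) (p : Expansion.{w} P A) :
    Function.Injective (mk q p) := fun f g h => by
  have := (mk_eq_mk_iff q p p f g).1 h
  rw [Expansion.nat_self, Category.comp_id] at this
  exact this.symm

theorem mk_surjective (q : Expansion.{w} P B) (p : Expansion.{w} P A) :
    Function.Surjective (mk q p) := by
  rintro ⟨⟨q', p', m⟩⟩
  refine ⟨Expansion.nat q q' ≫ m ≫ Expansion.nat p' p,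
    Quotient.sound (s := repSetoid P B A) ?_⟩
  change Expansion.nat q q' ≫ m = (Expansion.nat q q' ≫ m ≫ Expansion.nat p' p) ≫
    Expansion.nat p p'
  simp

/-- Coarse shape morphisms are the `pro*`-morphisms between fixed expansions. -/
noncomputable def equivPro (q : Expansion.{w} P B) (p : Expansion.{w} P A) :
    (q.sys ⟶ p.sys) ≃ Sh.{w} P B A :=
  Equiv.ofBijective (mk q p) ⟨mk_injective q p, mk_surjective q p⟩

theorem comp_mk_mk {D : C} (q : Expansion.{w} P D) (p : Expansion.{w} P B)
    (r : Expansion.{w} P A) (f : q.sys ⟶ p.sys) (h : p.sys ⟶ r.sys) :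
    comp (mk q p f) (mk p r h) = mk q r (f ≫ h) := by
  change mk q r (f ≫ Expansion.nat p p ≫ h) = _
  rw [Expansion.nat_self, Category.id_comp]

/-- Composing with the projection picks out the sequence of terms at `l`. Through this, every
statement about the basic sets becomes one about eventual equality of terms. -/
theorem comp_proj_eq_iff {hB : P B} (p : Expansion.{w} P A) (l : p.sys.Idx)
    (f g : StarMor (rudimentary B) p.sys) :
    comp (mk (Expansion.rud hB) p f.toPro) (proj p l) =
      comp (mk (Expansion.rud hB) p g.toPro) (proj p l) ↔
        ∃ N, ∀ n, N ≤ n → f.term n l = g.term n l := by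
  let π : StarMor p.sys (rudimentary (p.sys.obj l)) := OrdMor.toStar
    { idx := fun _ => l
      mor := fun _ => 𝟙 _
      comm := fun _ => ⟨l, le_rfl, le_rfl, by simp [rudimentary]⟩ }
  have key : ∀ f : StarMor (rudimentary B) p.sys,
      comp (mk (Expansion.rud hB) p f.toPro) (proj p l) =
        mk (Expansion.rud hB) (Expansion.rud (p.mem l)) (f.comp π).toPro := fun f =>
    comp_mk_mk (Expansion.rud hB) p (Expansion.rud (p.mem l)) f.toPro π.toPro
  have hterm : ∀ (f : StarMor (rudimentary B) p.sys) n, (f.comp π).term n PUnit.unit = f.term n l :=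
    fun f n => Category.comp_id (f.term n l)
  rw [key, key]
  refine (mk_injective _ _).eq_iff.trans (StarMor.toPro_eq_iff.trans ⟨fun h => ?_, fun h _ => ?_⟩)
  · obtain ⟨N, H⟩ := h PUnit.unit
    exact ⟨N, fun n hn => (hterm f n).symm.trans ((H n hn).trans (hterm g n))⟩
  · obtain ⟨N, H⟩ := h
    exact ⟨N, fun n hn => (hterm f n).trans ((H n hn).trans (hterm g n).symm)⟩

theorem exists_toPro {hB : P B} (p : Expansion.{w} P A) (F : Sh.{w} P B A) :
    ∃ f : StarMor (rudimentary B) p.sys, mk (Expansion.rud hB) p f.toPro = F := by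
  obtain ⟨F, rfl⟩ := mk_surjective (Expansion.rud hB) p F
  obtain ⟨f, rfl⟩ := StarMor.exists_toPro F
  exact ⟨f, rfl⟩

theorem mk_comp_natural {hB : P B} {p p' : Expansion.{w} P A} {i : OrdMor p.sys p'.sys}
    (hi : Expansion.IsNatural p p' i) (f : StarMor (rudimentary B) p.sys) :
    mk (Expansion.rud hB) p' (f.comp i.toStar).toPro = mk (Expansion.rud hB) p f.toPro := by
  refine ((mk_eq_mk_iff _ _ _ _ _).2 ?_).symm
  rw [Expansion.nat_eq hi]
  rfl

theorem comp_proj_eq_of_le (hB : P B) (p : Expansion.{w} P A) {l l' : p.sys.Idx} (h : l ≤ l')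
    {F G : Sh.{w} P B A} (hFG : comp F (proj p l') = comp G (proj p l')) :
    comp F (proj p l) = comp G (proj p l) := by
  obtain ⟨f, rfl⟩ := exists_toPro (hB := hB) p F
  obtain ⟨g, rfl⟩ := exists_toPro (hB := hB) p G
  rw [comp_proj_eq_iff] at hFG ⊢
  obtain ⟨N, H⟩ := hFG
  obtain ⟨N₁, H₁⟩ := f.exists_term_bond h
  obtain ⟨N₂, H₂⟩ := g.exists_term_bond h
  refine ⟨max N (max N₁ N₂), fun n hn => ?_⟩
  rw [← H₁ n (by omega), ← H₂ n (by omega), H n (by omega)]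

/-- The projection of `p'` at `l'` factors through a projection of `p` by the natural morphism. Thus
each basic set of one expansion is a neighbourhood, for the other, of each of its points. -/
theorem exists_comp_proj_eq (hB : P B) (p p' : Expansion.{w} P A) (l' : p'.sys.Idx) :
    ∃ l : p.sys.Idx, ∀ F G : Sh.{w} P B A, comp F (proj p l) = comp G (proj p l) →
      comp F (proj p' l') = comp G (proj p' l') := by
  obtain ⟨i, hi⟩ := Expansion.exists_natural p p'
  refine ⟨i.idx l', fun F G hFG => ?_⟩
  obtain ⟨f, rfl⟩ := exists_toPro (hB := hB) p F
  obtain ⟨g, rfl⟩ := exists_toPro (hB := hB) p G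
  obtain ⟨N, H⟩ := (comp_proj_eq_iff p _ f g).1 hFG
  rw [← mk_comp_natural hi, ← mk_comp_natural hi, comp_proj_eq_iff]
  exact ⟨N, fun n hn => congrArg (· ≫ i.mor l') (H n hn)⟩

/-- The topology generated by the basic sets of an expansion. -/
abbrev topology (p : Expansion.{w} P A) (B : C) : TopologicalSpace (Sh.{w} P B A) :=
  .generateFrom {V | ∃ (l : p.sys.Idx) (F : Sh.{w} P B A), V = basicSet p l F}

/-- For fixed `l` the basic sets are the classes of an equivalence relation, so any member may serve
as centre; directedness of the index set handles intersections. -/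
theorem isTopologicalBasis_self (hB : P B) (p : Expansion.{w} P A) :
    @TopologicalSpace.IsTopologicalBasis _ (topology p B)
      {V | ∃ (l : p.sys.Idx) (F : Sh.{w} P B A), V = basicSet p l F} := by
  let _ := topology p B
  refine ⟨?_, ?_, rfl⟩
  · rintro _ ⟨l, F, rfl⟩ _ ⟨l', F', rfl⟩ G ⟨hG, hG'⟩
    obtain ⟨m, hm, hm'⟩ := exists_ge_ge l l'
    exact ⟨_, ⟨m, G, rfl⟩, rfl, fun H hH => ⟨(comp_proj_eq_of_le hB p hm hH).trans hG,
      (comp_proj_eq_of_le hB p hm' hH).trans hG'⟩⟩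
  · obtain ⟨l⟩ := (inferInstance : Nonempty p.sys.Idx)
    exact Set.eq_univ_of_forall fun F => ⟨_, ⟨l, F, rfl⟩, rfl⟩

theorem isTopologicalBasis (hB : P B) (p p' : Expansion.{w} P A) :
    @TopologicalSpace.IsTopologicalBasis _ (topology p B)
      {V | ∃ (l : p'.sys.Idx) (F : Sh.{w} P B A), V = basicSet p' l F} := by
  let _ := topology p B
  have hb := isTopologicalBasis_self hB p
  refine TopologicalSpace.isTopologicalBasis_of_isOpen_of_nhds ?_ ?_
  · rintro _ ⟨l', F, rfl⟩
    obtain ⟨l, hl⟩ := exists_comp_proj_eq hB p p' l'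
    refine hb.isOpen_iff.2 fun G hG => ⟨_, ⟨l, G, rfl⟩, rfl, fun H hH => ?_⟩
    exact (hl H G hH).trans hG
  · intro G U hG hU
    obtain ⟨_, ⟨l, F, rfl⟩, hGF, hFU⟩ := hb.exists_subset_of_mem_open hG hU
    obtain ⟨l', hl'⟩ := exists_comp_proj_eq hB p' p l
    exact ⟨_, ⟨l', G, rfl⟩, rfl, fun H hH => hFU ((hl' H G hH).trans hGF)⟩

end Sh

end Generic

/-! ### The group structure and its compatibility with the topology -/

section Sphere

variable {k : ℕ} [NeZero k]

/-- Since `concat` reverses the factors, `sphereEquiv` is an anti-isomorphism, and the left axioms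
come from the right ones of the homotopy group. -/
noncomputable instance (P : PSpace.{u}) : Group (sphere.{u} k ⟶ P) :=
  letI : Mul (sphere.{u} k ⟶ P) := ⟨concat⟩
  letI : One (sphere.{u} k ⟶ P) := ⟨(sphereEquiv P).symm 1⟩
  letI : Inv (sphere.{u} k ⟶ P) := ⟨fun a => (sphereEquiv P).symm (sphereEquiv P a)⁻¹⟩
  have hmul : ∀ a b : sphere.{u} k ⟶ P,
      sphereEquiv P (a * b) = sphereEquiv P b * sphereEquiv P a := fun _ _ =>
    (sphereEquiv P).apply_symm_apply _
  have hone : sphereEquiv P (1 : sphere.{u} k ⟶ P) = 1 := (sphereEquiv P).apply_symm_apply _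
  have hinv : ∀ a : sphere.{u} k ⟶ P, sphereEquiv P a⁻¹ = (sphereEquiv P a)⁻¹ := fun _ =>
    (sphereEquiv P).apply_symm_apply _
  Group.ofLeftAxioms
    (fun a b c => (sphereEquiv P).injective (by rw [hmul, hmul, hmul, hmul, mul_assoc]))
    (fun a => (sphereEquiv P).injective (by rw [hmul, hone, mul_one]))
    (fun a => (sphereEquiv P).injective (by rw [hmul, hinv, hone, mul_inv_cancel]))

/-- Composition with a morphism is a homomorphism of homotopy groups. -/
noncomputable def postcompHom {P Q : PSpace.{u}} (h : P ⟶ Q) :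
    (sphere.{u} k ⟶ P) →* (sphere.{u} k ⟶ Q) :=
  MonoidHom.mk' (fun a => a ≫ h) fun a b => concat_comp a b h

namespace StarMor

variable {X : InvSystem.{u} PSpace.{u}}

theorem term_add (f g : StarMor (rudimentary (sphere.{u} k)) X) (n l) :
    (f.add g).term n l = f.term n l * g.term n l := rfl

/-- The constant `S*`-morphism. -/
noncomputable def zero (X : InvSystem.{u} PSpace.{u}) : StarMor (rudimentary (sphere.{u} k)) X :=
  ofTerm (fun _ _ => 1) fun _ _ h => ⟨0, fun _ _ => map_one (postcompHom (k := k) (X.bond h))⟩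

/-- The termwise inverse of an `S*`-morphism. -/
noncomputable def neg (f : StarMor (rudimentary (sphere.{u} k)) X) :
    StarMor (rudimentary (sphere.{u} k)) X :=
  ofTerm (fun n l => (f.term n l)⁻¹) fun l l' h => by
    obtain ⟨N, H⟩ := f.exists_term_bond h
    exact ⟨N, fun n hn => (map_inv (postcompHom (k := k) (X.bond h)) _).trans (congrArg _ (H n hn))⟩

theorem term_zero (n : ℕ) (l : X.Idx) : (zero (k := k) X).term n l = 1 := rfl

theorem term_neg (f : StarMor (rudimentary (sphere.{u} k)) X) (n l) :
    f.neg.term n l = (f.term n l)⁻¹ := rfl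

end StarMor

open StarMor in
/-- The group of `pro*`-morphisms from a sphere. -/
noncomputable instance (X : InvSystem.{u} PSpace.{u}) :
    Group (rudimentary (sphere.{u} k) ⟶ X) :=
  letI : Mul (rudimentary (sphere.{u} k) ⟶ X) := ⟨Quotient.map₂ add fun f f' hf g g' hg => by
    refine Quotient.exact (toPro_eq_iff.2 fun l => ?_)
    obtain ⟨N, H⟩ := evAgree_rudimentary_iff.1 (hf l)
    obtain ⟨M, H'⟩ := evAgree_rudimentary_iff.1 (hg l)
    exact ⟨max N M, fun n hn => congrArg₂ concat (H n (le_of_max_le_left hn))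
      (H' n (le_of_max_le_right hn))⟩⟩
  letI : One (rudimentary (sphere.{u} k) ⟶ X) := ⟨(zero X).toPro⟩
  letI : Inv (rudimentary (sphere.{u} k) ⟶ X) := ⟨Quotient.map neg fun f f' hf => by
    refine Quotient.exact (toPro_eq_iff.2 fun l => ?_)
    obtain ⟨N, H⟩ := evAgree_rudimentary_iff.1 (hf l)
    exact ⟨N, fun n hn => congrArg (fun a : sphere.{u} k ⟶ X.obj l => a⁻¹) (H n hn)⟩⟩
  Group.ofLeftAxioms
    (by
      rintro ⟨f⟩ ⟨g⟩ ⟨h⟩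
      exact toPro_eq_of_term fun n l => by simp only [term_add, mul_assoc])
    (by
      rintro ⟨f⟩
      exact toPro_eq_of_term fun n l => by simp only [term_add, term_zero, one_mul])
    (by
      rintro ⟨f⟩
      exact toPro_eq_of_term fun n l => by
        simp only [term_add, term_zero, term_neg, inv_mul_cancel])

noncomputable instance (hS : HPol (sphere.{u} k)) (X : InvSystem.{u} PSpace.{u}) :
    Group ((Expansion.rud.{u} hS).sys ⟶ X) :=
  inferInstanceAs (Group (rudimentary.{u} (sphere.{u} k) ⟶ X))

namespace Sh

variable {A : PSpace.{u}}

/-- The group structure on coarse shape morphisms from a sphere, in terms of an expansion. -/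
noncomputable abbrev group (hS : HPol (sphere.{u} k)) (p : Expansion.{u} HPol A) :
    Group (Sh.{u} HPol (sphere.{u} k) A) :=
  (equivPro (Expansion.rud hS) p).symm.group

theorem mk_mul_mk_self (hS : HPol (sphere.{u} k)) (p : Expansion.{u} HPol A)
    (f g : StarMor (rudimentary (sphere.{u} k)) p.sys) :
    letI := group hS p
    mk (Expansion.rud hS) p f.toPro * mk (Expansion.rud hS) p g.toPro =
      mk (Expansion.rud hS) p (f.add g).toPro := by
  let e := equivPro (Expansion.rud hS) p
  have h : ∀ f, e.symm (mk (Expansion.rud hS) p f) = f := fun f => e.symm_apply_apply f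
  exact congrArg e (congrArg₂ (· * ·) (h f.toPro) (h g.toPro))

theorem inv_mk_self (hS : HPol (sphere.{u} k)) (p : Expansion.{u} HPol A)
    (f : StarMor (rudimentary (sphere.{u} k)) p.sys) :
    letI := group hS p
    (mk (Expansion.rud hS) p f.toPro)⁻¹ = mk (Expansion.rud hS) p f.neg.toPro := by
  let e := equivPro (Expansion.rud hS) p
  have h : ∀ f, e.symm (mk (Expansion.rud hS) p f) = f := fun f => e.symm_apply_apply f
  exact congrArg e (congrArg (·⁻¹) (h f.toPro))

/-- Independence of the expansion: the natural morphism from `p'` to `p` is a homomorphism on each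
term, so termwise sums over `p'` and over `p` represent the same class. -/
theorem mk_mul_mk (hS : HPol (sphere.{u} k)) (p p' : Expansion.{u} HPol A)
    (f g : StarMor (rudimentary (sphere.{u} k)) p'.sys) :
    letI := group hS p
    mk (Expansion.rud hS) p' f.toPro * mk (Expansion.rud hS) p' g.toPro =
      mk (Expansion.rud hS) p' (f.add g).toPro := by
  obtain ⟨i, hi⟩ := Expansion.exists_natural p' p
  have h := mk_mul_mk_self hS p (f.comp i.toStar) (g.comp i.toStar)
  rw [mk_comp_natural hi, mk_comp_natural hi] at h
  rw [h, ← mk_comp_natural hi (f.add g)]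
  refine congrArg _ (StarMor.toPro_eq_of_term fun n l => ?_)
  exact (concat_comp (f.term n (i.idx l)) (g.term n (i.idx l)) (i.mor l)).symm

/-- The term of a sum at `l` depends only on the terms of the summands at `l`; so the product of the
basic sets at `l` around `F` and `G` lies in the one around `F * G`, which is continuity of the
operation. -/
theorem comp_proj_mul (hS : HPol (sphere.{u} k)) (p : Expansion.{u} HPol A) (l : p.sys.Idx)
    {F F' G G' : Sh.{u} HPol (sphere.{u} k) A} (hF : comp F (proj p l) = comp F' (proj p l))
    (hG : comp G (proj p l) = comp G' (proj p l)) :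
    letI := group hS p
    comp (F * G) (proj p l) = comp (F' * G') (proj p l) := by
  obtain ⟨f, rfl⟩ := exists_toPro (hB := hS) p F
  obtain ⟨f', rfl⟩ := exists_toPro (hB := hS) p F'
  obtain ⟨g, rfl⟩ := exists_toPro (hB := hS) p G
  obtain ⟨g', rfl⟩ := exists_toPro (hB := hS) p G'
  obtain ⟨N, H⟩ := (comp_proj_eq_iff p l f f').1 hF
  obtain ⟨M, H'⟩ := (comp_proj_eq_iff p l g g').1 hG
  rw [mk_mul_mk_self, mk_mul_mk_self, comp_proj_eq_iff]
  exact ⟨max N M, fun n hn => congrArg₂ concat (H n (le_of_max_le_left hn))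
    (H' n (le_of_max_le_right hn))⟩

theorem comp_proj_inv (hS : HPol (sphere.{u} k)) (p : Expansion.{u} HPol A) (l : p.sys.Idx)
    {F F' : Sh.{u} HPol (sphere.{u} k) A} (hF : comp F (proj p l) = comp F' (proj p l)) :
    letI := group hS p
    comp F⁻¹ (proj p l) = comp F'⁻¹ (proj p l) := by
  obtain ⟨f, rfl⟩ := exists_toPro (hB := hS) p F
  obtain ⟨f', rfl⟩ := exists_toPro (hB := hS) p F'
  obtain ⟨N, H⟩ := (comp_proj_eq_iff p l f f').1 hF
  rw [inv_mk_self, inv_mk_self, comp_proj_eq_iff]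
  exact ⟨N, fun n hn => by rw [StarMor.term_neg, StarMor.term_neg, H n hn]⟩

theorem isTopologicalGroup (hS : HPol (sphere.{u} k)) (p : Expansion.{u} HPol A) :
    letI := group hS p
    letI := topology p (sphere.{u} k)
    IsTopologicalGroup (Sh.{u} HPol (sphere.{u} k) A) := by
  let := group hS p
  let := topology p (sphere.{u} k)
  have hb := isTopologicalBasis_self hS p
  have hopen : ∀ l F, IsOpen (basicSet p l F : Set (Sh.{u} HPol (sphere.{u} k) A)) := fun l F =>
    hb.isOpen ⟨l, F, rfl⟩
  refine { continuous_mul := hb.continuous_iff.2 ?_, continuous_inv := hb.continuous_iff.2 ?_ }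
  · rintro _ ⟨l, F, rfl⟩
    refine isOpen_iff_mem_nhds.2 fun a ha => ?_
    refine Filter.mem_of_superset (prod_mem_nhds ((hopen l a.1).mem_nhds rfl)
      ((hopen l a.2).mem_nhds rfl)) fun b hb => ?_
    exact (comp_proj_mul hS p l hb.1 hb.2).trans ha
  · rintro _ ⟨l, F, rfl⟩
    refine isOpen_iff_mem_nhds.2 fun a ha => ?_
    refine Filter.mem_of_superset ((hopen l a).mem_nhds rfl) fun b hb => ?_
    exact (comp_proj_inv hS p l hb).trans ha

end Sh

end Sphere

end CoarseShape

theorem theorem4p1 (X : PSpace.{u}) (k : ℕ) [NeZero k] :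
    ∃ (hS : HPol (sphere.{u} k)) (_ : Group (Sh.{u} HPol (sphere.{u} k) X))
      (_ : TopologicalSpace (Sh.{u} HPol (sphere.{u} k) X)),
      (∀ (p : Expansion.{u} HPol X) (f g : StarMor (rudimentary (sphere.{u} k)) p.sys),
        Sh.mk (Expansion.rud hS) p f.toPro * Sh.mk (Expansion.rud hS) p g.toPro =
          Sh.mk (Expansion.rud hS) p (f.add g).toPro) ∧
      (∀ p : Expansion.{u} HPol X,
        TopologicalSpace.IsTopologicalBasis
          {V | ∃ (l : p.sys.Idx) (F : Sh.{u} HPol (sphere.{u} k) X), V = Sh.basicSet p l F}) ∧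
      IsTopologicalGroup (Sh.{u} HPol (sphere.{u} k) X) := by
  -- This expansion only serves to define the structures; the first two claims then hold for all
  -- expansions by independence of the choice.
  obtain ⟨p⟩ := exists_expansion X
  have hS := hPol_sphere.{u} k
  exact ⟨hS, Sh.group hS p, Sh.topology p _, Sh.mk_mul_mk hS p, Sh.isTopologicalBasis hS p,
    Sh.isTopologicalGroup hS p⟩
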